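/- A mixed graph has a finite vertex set $V$, a set of undirected edges and a set of arcs (directed edges). There are no loops, and two distinct vertices are joined by at most one edge or arc (so an arc is never parallel to an edge or opposite to another arc). It is totally $(r,z)$-regular if every vertex is incident with $r$ edges and has out-degree $z$ and in-degree $z$ with respect to the arcs. The distance $d(u,v)$ is the least length of a walk from $u$ to $v$ that uses edges (in either direction) and arcs (in their direction). The out-eccentricity of $u$ is $\max_v d(u,v)$. The radius and the diameter are the minimum and the maximum of the out-eccentricities. Let $N_0=1$, $N_1=r+z$, $N_i=(r+z-1)N_{i-1}+zN_{i-2}$ for $i\ge 2$, and let $M(r,z,k)=\sum_{i=0}^k N_i$ be the mixed Moore bound and $s_{r,z,k}=\sum_{i=0}^k iN_i$ the status of a vertex of a mixed Moore graph. A $(r,z,k)$-mixed radial Moore graph is a totally $(r,z)$-regular mixed graph of radius $k$, diameter $k+1$ and order $M(r,z,k)$. The status of a vertex $v$ is $s(v)=\sum_{u}d(v,u)$. The status vector of $G$ lists the statuses of all vertices, up to order; $s_1^{n_1},s_2^{n_2},\dots$ means that $n_i$ vertices have status $s_i$. For integers $p\ge1$ let $N_p(G)=\bigl(\sum_v |s(v)-s_{r,z,k}|^p\bigr)^{1/p}$.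 In the status-norm ranking, $G$ precedes $H$ if there is $l\ge 1$ with $N_p(G)=N_p(H)$ for $1\le p<l$ and $N_l(G)<N_l(H)$. Let $G_1$ and $G_2$ be the mixed graphs on $\{0,1,\dots,10\}$ whose edges form the two cycles $0\,1\,2\,3\,4\,5$ (of length 6) and $6\,7\,8\,9\,10$ (of length 5), and whose arcs form the following directed cycles: - for $G_1$: $0\to6\to3\to0$, $1\to8\to4\to7\to1$, $5\to9\to2\to10\to5$; - for $G_2$: $0\to6\to3\to5\to9\to2\to10\to0$, $1\to8\to4\to7\to1$. **Proposition.** There are exactly $9486$ $(2,1,2)$-mixed radial Moore graphs up to isomorphism. $G_1$ and $G_2$ are two non-isomorphic ones. Both have status vector $17^4,18^6,19^1$, hence status norm $N_1(G_1)=N_1(G_2)=8$. They are the first two in the status-norm ranking: each of them precedes every $(2,1,2)$-mixed radial Moore graph that is isomorphic to neither of them. -/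

import Mathlib

/-- A mixed graph on the vertex set `V`: a set of undirected edges and a set of arcs.  Any two
distinct vertices are joined in at most one way (by one edge or by one arc in one of the two
directions), and there are no loops. -/
@[ext]
structure MixedGraph (V : Type*) where
  edges : SimpleGraph V
  arcs : Digraph V
  /-- no loops and no pairs of opposite arcs -/
  arcs_asymm : ∀ u v, arcs.Adj u v → ¬ arcs.Adj v u
  /-- no arc is parallel to an edge -/
  edges_disjoint_arcs : ∀ u v, edges.Adj u v → ¬ arcs.Adj u v

namespace MixedGraph

/-- One can go from `u` to `v` in one step: along an edge or along an arc. -/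
def Step {V : Type*} (G : MixedGraph V) (u v : V) : Prop :=
  G.edges.Adj u v ∨ G.arcs.Adj u v

/-- There is a walk of length `n` from `u` to `v`. -/
def HasWalk {V : Type*} (G : MixedGraph V) : ℕ → V → V → Prop
  | 0, u, v => u = v
  | n + 1, u, v => ∃ w, G.Step u w ∧ G.HasWalk n w v

/-- The distance from `u` to `v`: the least length of a walk from `u` to `v` (which is then a
path), and `⊤` if there is none. -/
noncomputable def dist {V : Type*} (G : MixedGraph V) (u v : V) : ℕ∞ :=
  ⨅ (n : ℕ) (_ : G.HasWalk n u v), (n : ℕ∞)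

/-- The out-eccentricity of a vertex. -/
noncomputable def outEcc {V : Type*} (G : MixedGraph V) (u : V) : ℕ∞ :=
  ⨆ v, G.dist u v

/-- The radius: the minimum out-eccentricity. -/
noncomputable def radius {V : Type*} (G : MixedGraph V) : ℕ∞ :=
  ⨅ u, G.outEcc u

/-- The diameter: the maximum distance from a vertex to a vertex. -/
noncomputable def diam {V : Type*} (G : MixedGraph V) : ℕ∞ :=
  ⨆ u, G.outEcc u

/-- Totally regular of degrees `(r, z)`: every vertex has undirected degree `r` and both
out-degree and in-degree `z`. -/
def IsTotallyRegular {V : Type*} (G : MixedGraph V) (r z : ℕ) : Prop :=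
  ∀ v, {w | G.edges.Adj v w}.encard = r ∧
    {w | G.arcs.Adj v w}.encard = z ∧ {w | G.arcs.Adj w v}.encard = z

/-- The status of a vertex: the sum of the distances from it to all vertices. -/
noncomputable def status {V : Type*} [Fintype V] (G : MixedGraph V) (v : V) : ℕ∞ :=
  ∑ u, G.dist v u

/-- The status vector, up to the order of its entries: the multiset of all statuses. -/
noncomputable def statusVector {V : Type*} [Fintype V] (G : MixedGraph V) : Multiset ℕ∞ :=
  (Finset.univ : Finset V).val.map G.status

/-- The number `N_i` of vertices at distance `i` from the root of the `(r, z)` Moore tree: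
`N_0 = 1`, `N_1 = r + z` and `N_i = (r + z - 1) N_{i-1} + z N_{i-2}`.  (If `r + z = 0`, the
truncated difference is multiplied by `N_{i-1} = 0`.) -/
def mooreLevel (r z : ℕ) : ℕ → ℕ
  | 0 => 1
  | 1 => r + z
  | i + 2 => (r + z - 1) * mooreLevel r z (i + 1) + z * mooreLevel r z i

/-- The mixed Moore bound `M(r, z, k)`, the order of the Moore tree of depth `k`. -/
def mooreBound (r z k : ℕ) : ℕ :=
  ∑ i ∈ Finset.range (k + 1), mooreLevel r z i

/-- The status of every vertex of a mixed Moore graph with parameters `(r, z, k)`. -/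
def mooreStatus (r z k : ℕ) : ℕ :=
  ∑ i ∈ Finset.range (k + 1), i * mooreLevel r z i

/-- `G` is an `(r, z, k)`-mixed radial Moore graph. -/
def IsRadialMoore {V : Type*} (G : MixedGraph V) (r z k : ℕ) : Prop :=
  G.IsTotallyRegular r z ∧ G.radius = k ∧ G.diam = k + 1 ∧ ENat.card V = mooreBound r z k

/-- Isomorphic mixed graphs: a bijection of the vertices preserves edges and arcs, both ways. -/
def Isomorphic {V W : Type*} (G : MixedGraph V) (H : MixedGraph W) : Prop :=
  ∃ e : V ≃ W, (∀ u v, H.edges.Adj (e u) (e v) ↔ G.edges.Adj u v) ∧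
    ∀ u v, H.arcs.Adj (e u) (e v) ↔ G.arcs.Adj u v

/-- Isomorphism, as an equivalence relation on the `(r, z, k)`-mixed radial Moore graphs with
vertex set `{0, …, M(r, z, k) - 1}`. -/
def isoSetoid (r z k : ℕ) :
    Setoid {G : MixedGraph (Fin (mooreBound r z k)) // G.IsRadialMoore r z k} where
  r G H := G.1.Isomorphic H.1
  iseqv :=
    { refl := fun _ => ⟨Equiv.refl _, fun _ _ => Iff.rfl, fun _ _ => Iff.rfl⟩
      symm := by
        rintro _ _ ⟨e, h1, h2⟩
        exact ⟨e.symm, fun u v => by simpa using (h1 (e.symm u) (e.symm v)).symm,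
          fun u v => by simpa using (h2 (e.symm u) (e.symm v)).symm⟩
      trans := by
        rintro _ _ _ ⟨e, h1, h2⟩ ⟨f, h3, h4⟩
        exact ⟨e.trans f, fun u v => (h3 _ _).trans (h1 u v),
          fun u v => (h4 _ _).trans (h2 u v)⟩ }

/-- `RM(r, z, k)`: the isomorphism classes of `(r, z, k)`-mixed radial Moore graphs. -/
def RM (r z k : ℕ) : Type :=
  Quotient (isoSetoid r z k)

/-- `N_p(G) = ‖s(G) - s_{r,z,k}‖_p`, the `ℓ^p` distance from the status vector of `G` to the
constant vector whose entries are the status of a vertex in a mixed Moore graph.  It is used for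
graphs of finite diameter, all of whose statuses are natural numbers. -/
noncomputable def statusNorm {V : Type*} [Fintype V] (G : MixedGraph V) (r z k p : ℕ) : ℝ :=
  (∑ v, |((G.status v).toNat : ℝ) - (mooreStatus r z k : ℝ)| ^ p) ^ (1 / (p : ℝ))

/-- `G` precedes `H` in the ranking of the `(r, z, k)`-mixed radial Moore graphs (`G` is closer
than `H` to being a mixed Moore graph): at the first positive integer `p` at which the status norms
differ, that of `G` is smaller. -/
def Closer {V W : Type*} [Fintype V] [Fintype W] (r z k : ℕ)
    (G : MixedGraph V) (H : MixedGraph W) : Prop :=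
  ∃ l : ℕ, 0 < l ∧ (∀ p, 0 < p → p < l → G.statusNorm r z k p = H.statusNorm r z k p) ∧
    G.statusNorm r z k l < H.statusNorm r z k l

/-- The disjoint union of the 6-cycle `0 1 2 3 4 5` and the 5-cycle `6 7 8 9 10`. -/
def hexagonPentagon : SimpleGraph (Fin 11) :=
  SimpleGraph.fromRel fun u v => (u, v) ∈
    ([(0, 1), (1, 2), (2, 3), (3, 4), (4, 5), (5, 0),
      (6, 7), (7, 8), (8, 9), (9, 10), (10, 6)] : List (Fin 11 × Fin 11))

/-- The mixed graph `G₁`: its arcs form the directed cycles `0 → 6 → 3 → 0`,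
`1 → 8 → 4 → 7 → 1` and `5 → 9 → 2 → 10 → 5`. -/
def G₁ : MixedGraph (Fin 11) where
  edges := hexagonPentagon
  arcs := { Adj := fun u v => (u, v) ∈
    ([(0, 6), (6, 3), (3, 0),
      (1, 8), (8, 4), (4, 7), (7, 1),
      (5, 9), (9, 2), (2, 10), (10, 5)] : List (Fin 11 × Fin 11)) }
  arcs_asymm := by decide
  edges_disjoint_arcs := by
    simp only [hexagonPentagon, SimpleGraph.fromRel_adj]
    decide

/-- The mixed graph `G₂`: its arcs form the directed cycles
`0 → 6 → 3 → 5 → 9 → 2 → 10 → 0` and `1 → 8 → 4 → 7 → 1`. -/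
def G₂ : MixedGraph (Fin 11) where
  edges := hexagonPentagon
  arcs := { Adj := fun u v => (u, v) ∈
    ([(0, 6), (6, 3), (3, 5), (5, 9), (9, 2), (2, 10), (10, 0),
      (1, 8), (8, 4), (4, 7), (7, 1)] : List (Fin 11 × Fin 11)) }
  arcs_asymm := by decide
  edges_disjoint_arcs := by
    simp only [hexagonPentagon, SimpleGraph.fromRel_adj]
    decide

end MixedGraph

/-!
The proof is an exhaustive search, whose correctness is proved and which the kernel evaluates.

*The search space.*  A totally `(2, 1)`-regular graph is given by three functions `a`, `b`, `p`: the
two neighbours along edges and the neighbour along the arc (`Nbrs`).  It has `11` vertices, just as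
the Moore tree of depth two: the root, its out-neighbours along two edges and an arc, and the seven
other ends of the steps from these.  So the Moore tree of a central vertex contains every vertex and
serves to label the graph by `0, …, 10` (`Nbrs.exists_rooted`).  A graph labelled in this way is
called `Rooted`.  Rooted graphs are enumerated as triples of numbers whose hexadecimal digits are
the values of `a`, `b` and `p` (`Coded`, `rootedTables`, `Rooted.exists_mem`): first the edges, then
the arcs from the vertices `4, …, 10`.

*Isomorphism.*  A graph has four labellings by the Moore tree of a given central vertex, as the two
neighbours of the root may be exchanged, and so may the two neighbours of the head of the arc from
the root.  Hence the rooted graphs isomorphic to a given one are found among at most `44`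
relabellings.  Each rooted graph has a key, a pair of numbers from which it can be recovered
(`Rooted.eq_of_keys_eq`), and the test `accepted` demands that no relabelling has a smaller key.  So
every isomorphism class contains exactly one accepted graph (`exists_accepted`, `eq_of_isomorphic`).
Before the arcs are chosen, a necessary condition on the edges discards most choices of edges
(`edgesLeast_of_isLeast`).

*Statuses.*  In a graph of diameter at most three the status of a vertex is `17` plus the number of
vertices outside its ball of radius two, its `deficit` (`Coded.status_eq`).  Hence the status norm
`N_p` is the `ℓ^p` norm of the vector of deficits, which for `G₁` and `G₂` consists of four zeros,
six ones and one two.  For every accepted graph the search checks that the sum of the deficits is at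
least `8`, and that when it is `8`, the sum of the squares exceeds `10` unless the graph is the
representative of `G₁` or of `G₂` (`far_iff`).

*The evaluation.*  Both results are read off from one number: each accepted graph has the weight `1`
if it passes the last check and `10000` otherwise, and the total weight turns out to be `9486`
(`sum_ownWeight`).  Thus there are `9486` accepted graphs, and all of them pass.
-/

namespace MixedGraph

noncomputable section

/-! ### Arithmetic that the kernel evaluates quickly -/

/-- `f x`, arranged so that the kernel reduces `x` to a numeral before it substitutes it. -/
def force {α : Type} (x : ℕ) (f : ℕ → α) : α := Nat.rec (f 0) (fun n _ => f n) (Nat.succ x)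

/-- Conjunction whose second argument is evaluated only if it is needed. -/
def band (b c : Bool) : Bool := Bool.rec false c b

/-- Disjunction whose second argument is evaluated only if it is needed. -/
def bor (b c : Bool) : Bool := Bool.rec c true b

/-- Selection, by the Boolean recursor itself. -/
def sel {α : Type} (b : Bool) (x y : α) : α := Bool.rec y x b

/-- Conjunction of a Boolean function over a list. -/
def allOf (f : ℕ → Bool) (l : List ℕ) : Bool := List.rec true (fun i _ ih => band (f i) ih) l

/-- Sum of a function over a list. -/
def sumOf {α : Type} (f : α → ℕ) (l : List α) : ℕ := List.rec 0 (fun i _ ih => Nat.add (f i) ih) l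

/-- The list with its first occurrence of `t` deleted. -/
def remove (t : ℕ) (l : List ℕ) : List ℕ :=
  List.rec [] (fun x xs ih => sel (Nat.beq x t) xs (x :: ih)) l

/-- The number whose digits in base `2 ^ w`, lowest first, are the values of `f` on the list. -/
def pack (w : ℕ) (f : ℕ → ℕ) (l : List ℕ) : ℕ :=
  List.rec 0 (fun i _ ih => Nat.add (f i) (Nat.shiftLeft ih w)) l

/-- The hexadecimal digit at position `i`: a number codes a function on `{0, …, 10}` in this
way. -/
def look (T i : ℕ) : ℕ := Nat.mod (Nat.shiftRight T (Nat.mul 4 i)) 16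

/-- The block of 11 binary digits at position `i`: a number codes an `11 × 11` matrix of zeros
and ones in this way. -/
def row (T i : ℕ) : ℕ := Nat.mod (Nat.shiftRight T (Nat.mul 11 i)) 2048

/-- The number of ones among the 11 binary digits of `m`: the product repeats the digits at
distances of 12 places, the mask keeps every fifth place, and the residue modulo `31` adds up the
digits in base 32. -/
def popcount (m : ℕ) : ℕ :=
  Nat.mod (Nat.land (Nat.mul 0x1001001001001 m) 0x8421084210842108421) 31

@[simp] theorem force_eq {α : Type} (x : ℕ) (f : ℕ → α) : force x f = f x := rfl

@[simp] theorem band_eq_true (b c : Bool) : band b c = true ↔ b = true ∧ c = true := by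
  cases b <;> simp [band]

@[simp] theorem bor_eq_true (b c : Bool) : bor b c = true ↔ b = true ∨ c = true := by
  cases b <;> simp [bor]

theorem sel_eq {α : Type} (b : Bool) (x y : α) : sel b x y = if b = true then x else y := by
  cases b <;> simp [sel]

@[simp] theorem allOf_eq_true (f : ℕ → Bool) (l : List ℕ) :
    allOf f l = true ↔ ∀ i ∈ l, f i = true := by
  induction l with
  | nil => simp [allOf]
  | cons i l ih =>
    rw [List.forall_mem_cons, ← ih]
    exact band_eq_true _ _

theorem sumOf_eq {α : Type} (f : α → ℕ) (l : List α) : sumOf f l = (l.map f).sum := by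
  induction l with
  | nil => rfl
  | cons i l ih =>
    rw [List.map_cons, List.sum_cons, ← ih]
    rfl

theorem remove_eq (t : ℕ) (l : List ℕ) : remove t l = l.erase t := by
  induction l with
  | nil => rfl
  | cons x l ih =>
    rw [List.erase_cons, ← ih]
    change sel (Nat.beq x t) l (x :: remove t l) = _
    rw [sel_eq]
    simp

theorem pack_cons (w : ℕ) (f : ℕ → ℕ) (i : ℕ) (l : List ℕ) :
    pack w f (i :: l) = f i + 2 ^ w * pack w f l := by
  change f i + (pack w f l) <<< w = _
  rw [Nat.shiftLeft_eq, mul_comm]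

theorem look_eq (T i : ℕ) : look T i = T / 2 ^ (4 * i) % 2 ^ 4 := by
  change T >>> (4 * i) % 16 = _
  rw [Nat.shiftRight_eq_div_pow]
  norm_num

theorem row_eq (T i : ℕ) : row T i = T / 2 ^ (11 * i) % 2 ^ 11 := by
  change T >>> (11 * i) % 2048 = _
  rw [Nat.shiftRight_eq_div_pow]
  norm_num

theorem row_lt (T i : ℕ) : row T i < 2048 := Nat.mod_lt _ (by norm_num)

theorem digit_pack (w : ℕ) (f : ℕ → ℕ) (l : List ℕ) (hf : ∀ i ∈ l, f i < 2 ^ w) (n : ℕ)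
    (hn : n < l.length) : pack w f l / 2 ^ (w * n) % 2 ^ w = f l[n] := by
  induction l generalizing n with
  | nil => simp at hn
  | cons i l ih =>
    rw [List.forall_mem_cons] at hf
    rw [pack_cons]
    cases n with
    | zero => simp [Nat.add_mul_mod_self_left, Nat.mod_eq_of_lt hf.1]
    | succ n =>
      rw [mul_add, mul_one, add_comm, pow_add, mul_comm (2 ^ (w * n)), ← Nat.div_div_eq_div_mul,
        Nat.add_comm, Nat.add_mul_div_left _ _ (by positivity), Nat.div_eq_of_lt hf.1, zero_add]
      simpa using ih hf.2 n (by simpa using hn)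

theorem pack_congr {w : ℕ} {f g : ℕ → ℕ} {l : List ℕ} (h : ∀ i ∈ l, f i = g i) :
    pack w f l = pack w g l := by
  induction l with
  | nil => rfl
  | cons i l ih =>
    rw [List.forall_mem_cons] at h
    rw [pack_cons, pack_cons, h.1, ih h.2]

theorem pack_inj {w : ℕ} {f g : ℕ → ℕ} {l : List ℕ} (hf : ∀ i ∈ l, f i < 2 ^ w)
    (hg : ∀ i ∈ l, g i < 2 ^ w) (h : pack w f l = pack w g l) : ∀ i ∈ l, f i = g i := by
  intro i hi
  obtain ⟨n, hn, rfl⟩ := List.getElem_of_mem hi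
  rw [← digit_pack w f l hf n hn, ← digit_pack w g l hg n hn, h]

/-- The vertices. -/
def verts : List ℕ := [0, 1, 2, 3, 4, 5, 6, 7, 8, 9, 10]

theorem mem_verts {i : ℕ} : i ∈ verts ↔ i < 11 := by
  simp only [verts, List.mem_cons, List.not_mem_nil, or_false]
  omega

theorem forall_mem_verts {q : ℕ → Prop} : (∀ i ∈ verts, q i) ↔ ∀ i : Fin 11, q i :=
  ⟨fun h i => h i (mem_verts.2 i.2), fun h i hi => h ⟨i, mem_verts.1 hi⟩⟩

theorem verts_getElem (i : Fin 11) : verts[(i : ℕ)]'i.2 = i := by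
  fin_cases i <;> rfl

theorem look_pack_verts {f : ℕ → ℕ} (hf : ∀ i ∈ verts, f i < 16) (i : Fin 11) :
    look (pack 4 f verts) i = f i := by
  rw [look_eq, digit_pack 4 f verts (by simpa using hf) i i.2, verts_getElem]

theorem row_pack_verts {f : ℕ → ℕ} (hf : ∀ i ∈ verts, f i < 2048) (i : Fin 11) :
    row (pack 11 f verts) i = f i := by
  rw [row_eq, digit_pack 11 f verts (by simpa using hf) i i.2, verts_getElem]

theorem look_pack_list {l : List ℕ} (hl : ∀ x ∈ l, x < 16) (n : ℕ) (hn : n < l.length) :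
    look (pack 4 (fun x => x) l) n = l[n] := by
  rw [look_eq, digit_pack 4 (fun x => x) l (by simpa using hl) n hn]

theorem popcount_eq (m : ℕ) (hm : m < 2048) :
    popcount m = ∑ j : Fin 11, (m.testBit j).toNat := by
  have h : ∀ m < 2048, popcount m = sumOf (fun j => (m.testBit j).toNat) verts := by
    decide +kernel
  rw [h m hm, sumOf_eq]
  simp [verts, Fin.sum_univ_succ]

theorem eq_2047_iff {m : ℕ} (hm : m < 2048) : m = 2047 ↔ ∀ j : Fin 11, m.testBit j = true := by
  constructor
  · rintro rfl
    decide
  · intro h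
    apply Nat.eq_of_testBit_eq
    intro i
    by_cases hi : i < 11
    · rw [h ⟨i, hi⟩]
      exact ((by decide : ∀ j : Fin 11, (2047 : ℕ).testBit j = true) ⟨i, hi⟩).symm
    · have hp : 2 ^ 11 ≤ 2 ^ i := Nat.pow_le_pow_right (by norm_num) (by omega)
      rw [Nat.testBit_lt_two_pow (by omega), Nat.testBit_lt_two_pow (by omega)]

/-! ### Distances, and invariance under isomorphism -/

theorem dist_le_iff {V : Type*} (G : MixedGraph V) (u v : V) (n : ℕ) :
    G.dist u v ≤ n ↔ ∃ m ≤ n, G.HasWalk m u v := by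
  constructor
  · intro h
    have h' : G.dist u v < ((n + 1 : ℕ) : ℕ∞) := lt_of_le_of_lt h (by exact_mod_cast n.lt_succ_self)
    simp only [dist, iInf_lt_iff] at h'
    obtain ⟨m, hm, hlt⟩ := h'
    exact ⟨m, Nat.lt_succ_iff.1 (by exact_mod_cast hlt), hm⟩
  · rintro ⟨m, hm, hw⟩
    exact (iInf₂_le m hw).trans (by exact_mod_cast hm)

theorem dist_le_zero {V : Type*} (G : MixedGraph V) (u v : V) :
    G.dist u v ≤ (0 : ℕ) ↔ u = v := by
  rw [dist_le_iff]
  simp [HasWalk]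

theorem dist_le_succ {V : Type*} (G : MixedGraph V) (u v : V) (n : ℕ) :
    G.dist u v ≤ (n + 1 : ℕ) ↔ u = v ∨ ∃ w, G.Step u w ∧ G.dist w v ≤ n := by
  simp only [dist_le_iff]
  constructor
  · rintro ⟨m, hm, hw⟩
    cases m with
    | zero => exact Or.inl hw
    | succ m =>
      obtain ⟨w, h1, h2⟩ := hw
      exact Or.inr ⟨w, h1, m, by omega, h2⟩
  · rintro (rfl | ⟨w, h1, m, hm, h2⟩)
    · exact ⟨0, by omega, rfl⟩
    · exact ⟨m + 1, by omega, w, h1, h2⟩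

theorem Isomorphic.symm {V W : Type*} {G : MixedGraph V} {H : MixedGraph W}
    (h : G.Isomorphic H) : H.Isomorphic G := by
  obtain ⟨e, h1, h2⟩ := h
  exact ⟨e.symm, fun u v => by simpa using (h1 (e.symm u) (e.symm v)).symm,
    fun u v => by simpa using (h2 (e.symm u) (e.symm v)).symm⟩

theorem Isomorphic.trans {U V W : Type*} {G : MixedGraph U} {H : MixedGraph V} {K : MixedGraph W}
    (h : G.Isomorphic H) (h' : H.Isomorphic K) : G.Isomorphic K := by
  obtain ⟨e, h1, h2⟩ := h
  obtain ⟨f, h3, h4⟩ := h'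
  exact ⟨e.trans f, fun u v => (h3 _ _).trans (h1 u v), fun u v => (h4 _ _).trans (h2 u v)⟩

/-- The mixed graph on `W` that corresponds to `G` under a bijection. -/
def comap {V W : Type*} (G : MixedGraph V) (e : W ≃ V) : MixedGraph W where
  edges := G.edges.comap e
  arcs := { Adj := fun u v => G.arcs.Adj (e u) (e v) }
  arcs_asymm := fun u v => G.arcs_asymm (e u) (e v)
  edges_disjoint_arcs := fun u v => G.edges_disjoint_arcs (e u) (e v)

theorem comap_isomorphic {V W : Type*} (G : MixedGraph V) (e : W ≃ V) :
    (G.comap e).Isomorphic G :=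
  ⟨e, fun _ _ => Iff.rfl, fun _ _ => Iff.rfl⟩

theorem eq_comap {V W : Type*} {G : MixedGraph V} {H : MixedGraph W} {e : W ≃ V}
    (h1 : ∀ u v, G.edges.Adj (e u) (e v) ↔ H.edges.Adj u v)
    (h2 : ∀ u v, G.arcs.Adj (e u) (e v) ↔ H.arcs.Adj u v) : H = G.comap e := by
  ext u v
  · exact (h1 u v).symm
  · exact (h2 u v).symm

theorem hasWalk_comap {V W : Type*} (G : MixedGraph V) (e : W ≃ V) (n : ℕ) (u v : W) :
    (G.comap e).HasWalk n u v ↔ G.HasWalk n (e u) (e v) := by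
  induction n generalizing u with
  | zero => simp [HasWalk]
  | succ n ih =>
    simp only [HasWalk, ih]
    exact (e.exists_congr fun w => Iff.rfl)

theorem dist_comap {V W : Type*} (G : MixedGraph V) (e : W ≃ V) (u v : W) :
    (G.comap e).dist u v = G.dist (e u) (e v) := by
  simp only [dist, hasWalk_comap]

theorem outEcc_comap {V W : Type*} (G : MixedGraph V) (e : W ≃ V) (u : W) :
    (G.comap e).outEcc u = G.outEcc (e u) := by
  simp only [outEcc, dist_comap]
  exact e.iSup_comp (g := fun v => G.dist (e u) v)

theorem IsRadialMoore.comap {V W : Type*} {G : MixedGraph V} {r z k : ℕ}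
    (h : G.IsRadialMoore r z k) (e : W ≃ V) : (G.comap e).IsRadialMoore r z k := by
  obtain ⟨h1, h2, h3, h4⟩ := h
  refine ⟨fun v => ?_, ?_, ?_, ?_⟩
  · obtain ⟨a1, a2, a3⟩ := h1 (e v)
    refine ⟨?_, ?_, ?_⟩
    · rw [← a1]
      exact (e.injective.encard_image _).symm.trans
        (congrArg _ (e.image_preimage {w | G.edges.Adj (e v) w}))
    · rw [← a2]
      exact (e.injective.encard_image _).symm.trans
        (congrArg _ (e.image_preimage {w | G.arcs.Adj (e v) w}))
    · rw [← a3]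
      exact (e.injective.encard_image _).symm.trans
        (congrArg _ (e.image_preimage {w | G.arcs.Adj w (e v)}))
  · rw [← h2]
    simp only [radius, outEcc_comap]
    exact e.iInf_comp (g := fun v => G.outEcc v)
  · rw [← h3]
    simp only [diam, outEcc_comap]
    exact e.iSup_comp (g := fun v => G.outEcc v)
  · rw [← h4]
    exact ENat.card_congr e

theorem IsRadialMoore.of_isomorphic {V W : Type*} {G : MixedGraph V} {H : MixedGraph W} {r z k : ℕ}
    (h : G.IsRadialMoore r z k) (hi : H.Isomorphic G) : H.IsRadialMoore r z k := by
  obtain ⟨e, h1, h2⟩ := hi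
  rw [eq_comap h1 h2]
  exact h.comap e

theorem status_comap {V W : Type*} [Fintype V] [Fintype W] (G : MixedGraph V) (e : W ≃ V) (u : W) :
    (G.comap e).status u = G.status (e u) := by
  simp only [status, dist_comap]
  exact e.sum_comp (fun v => G.dist (e u) v)

theorem statusNorm_of_isomorphic {V W : Type*} [Fintype V] [Fintype W] {G : MixedGraph V}
    {H : MixedGraph W} (h : G.Isomorphic H) (r z k p : ℕ) :
    G.statusNorm r z k p = H.statusNorm r z k p := by
  obtain ⟨e, h1, h2⟩ := h
  rw [eq_comap h1 h2]
  simp only [statusNorm, status_comap]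
  rw [e.sum_comp (fun v => |((H.status v).toNat : ℝ) - (mooreStatus r z k : ℝ)| ^ p)]

/-! ### Neighbour functions of a totally regular graph -/

/-- The edges at `v` lead to the two distinct vertices `a v` and `b v`, and the arc from `v` leads
to `p v`, where `p` is a permutation. -/
structure Nbrs {V : Type*} (G : MixedGraph V) (a b p : V → V) : Prop where
  edge : ∀ v w, G.edges.Adj v w ↔ w = a v ∨ w = b v
  ne : ∀ v, a v ≠ b v
  arc : ∀ v w, G.arcs.Adj v w ↔ w = p v
  bij : Function.Bijective p

theorem IsTotallyRegular.exists_nbrs {V : Type*} {G : MixedGraph V}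
    (h : G.IsTotallyRegular 2 1) : ∃ a b p, G.Nbrs a b p := by
  have h1 : ∀ v, ∃ x y, x ≠ y ∧ {w | G.edges.Adj v w} = {x, y} := fun v =>
    Set.encard_eq_two.1 (h v).1
  have h2 : ∀ v, ∃ x, {w | G.arcs.Adj v w} = {x} := fun v =>
    Set.encard_eq_one.1 (h v).2.1
  have h3 : ∀ v, ∃ x, {w | G.arcs.Adj w v} = {x} := fun v =>
    Set.encard_eq_one.1 (h v).2.2
  choose a b hab he using h1
  choose p hp using h2
  choose q hq using h3
  have hp' : ∀ v w, G.arcs.Adj v w ↔ w = p v := fun v w => by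
    simpa using Set.ext_iff.1 (hp v) w
  have hq' : ∀ v w, G.arcs.Adj w v ↔ w = q v := fun v w => by
    simpa using Set.ext_iff.1 (hq v) w
  refine ⟨a, b, p, fun v w => by simpa using Set.ext_iff.1 (he v) w, hab, hp', ?_, ?_⟩
  · intro u v huv
    rw [(hq' (p u) u).1 ((hp' u _).2 rfl), (hq' (p u) v).1 ((hp' v _).2 huv)]
  · intro v
    exact ⟨q v, ((hp' _ _).1 ((hq' v _).2 rfl)).symm⟩

theorem Nbrs.isTotallyRegular {V : Type*} {G : MixedGraph V} {a b p : V → V}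
    (h : G.Nbrs a b p) : G.IsTotallyRegular 2 1 := by
  intro v
  refine ⟨?_, ?_, ?_⟩
  · have : {w | G.edges.Adj v w} = {a v, b v} := by
      ext w
      simp [h.edge]
    rw [this]
    exact_mod_cast Set.encard_pair (h.ne v)
  · have : {w | G.arcs.Adj v w} = {p v} := by
      ext w
      simp [h.arc]
    rw [this]
    simp
  · obtain ⟨u, hu⟩ := h.bij.2 v
    have : {w | G.arcs.Adj w v} = {u} := by
      ext w
      simp only [h.arc, Set.mem_ofPred_eq, Set.mem_singleton_iff, ← hu, h.bij.1.eq_iff]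
      exact eq_comm
    rw [this]
    simp

theorem Nbrs.step_iff {V : Type*} {G : MixedGraph V} {a b p : V → V}
    (h : G.Nbrs a b p) (u v : V) : G.Step u v ↔ v = a u ∨ v = b u ∨ v = p u := by
  rw [Step, h.edge, h.arc, or_assoc]

theorem Nbrs.dist_le_succ {V : Type*} {G : MixedGraph V} {a b p : V → V}
    (h : G.Nbrs a b p) (u v : V) (n : ℕ) : G.dist u v ≤ (n + 1 : ℕ) ↔
      u = v ∨ G.dist (a u) v ≤ n ∨ G.dist (b u) v ≤ n ∨ G.dist (p u) v ≤ n := by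
  rw [MixedGraph.dist_le_succ]
  simp only [h.step_iff]
  aesop

theorem Nbrs.dist_le_one {V : Type*} {G : MixedGraph V} {a b p : V → V}
    (h : G.Nbrs a b p) (u v : V) : G.dist u v ≤ (1 : ℕ) ↔
      v = u ∨ v = a u ∨ v = b u ∨ v = p u := by
  rw [h.dist_le_succ u v 0]
  simp only [dist_le_zero, eq_comm]

theorem outEcc_le_iff {V : Type*} (G : MixedGraph V) (u : V) (n : ℕ) :
    G.outEcc u ≤ n ↔ ∀ v, G.dist u v ≤ n := by
  simp [outEcc]

/-- Every ball of radius one has only four vertices, so the radius is at least `2`. -/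
theorem Nbrs.isRadialMoore_iff {V : Type*} [Fintype V] {G : MixedGraph V} {a b p : V → V}
    (h : G.Nbrs a b p) (hV : Fintype.card V = 11) : G.IsRadialMoore 2 1 2 ↔
      (∃ u, ∀ v, G.dist u v ≤ (2 : ℕ)) ∧ (∀ u v, G.dist u v ≤ (3 : ℕ)) ∧
        ∃ u v, ¬ G.dist u v ≤ (2 : ℕ) := by
  have hne : Nonempty V := Fintype.card_pos_iff.1 (by omega)
  constructor
  · rintro ⟨-, h2, h3, -⟩
    refine ⟨?_, ?_, ?_⟩
    · have hlt : G.radius < (3 : ℕ) := by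
        rw [h2]
        norm_num
      rw [radius, iInf_lt_iff] at hlt
      obtain ⟨u, hu⟩ := hlt
      refine ⟨u, (outEcc_le_iff G u 2).1 ?_⟩
      exact Order.le_of_lt_add_one (by simpa [one_add_one_eq_two, two_add_one_eq_three] using hu)
    · intro u
      rw [← outEcc_le_iff]
      calc G.outEcc u ≤ G.diam := le_iSup G.outEcc u
        _ ≤ _ := by
          rw [h3]
          norm_num
    · by_contra! hc
      have : G.diam ≤ (2 : ℕ) := iSup_le fun u => (outEcc_le_iff G u 2).2 (hc u)
      rw [h3] at this
      norm_num at this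
  · rintro ⟨⟨u, hu⟩, h3, x, y, hxy⟩
    refine ⟨h.isTotallyRegular, ?_, ?_, ?_⟩
    · apply le_antisymm
      · exact (iInf_le _ u).trans ((outEcc_le_iff G u 2).2 hu)
      · refine le_iInf fun v => ?_
        by_contra! hlt
        have h1 : G.outEcc v ≤ (1 : ℕ) :=
          Order.le_of_lt_add_one (by simpa [one_add_one_eq_two] using hlt)
        rw [outEcc_le_iff] at h1
        classical
        have hsub : (Finset.univ : Finset V) ⊆ {v, a v, b v, p v} := fun w _ => by
          simpa using (h.dist_le_one v w).1 (h1 w)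
        have := (Finset.card_le_card hsub).trans Finset.card_le_four
        rw [Finset.card_univ] at this
        omega
    · apply le_antisymm
      · refine iSup_le fun v => (((outEcc_le_iff G v 3).2 (h3 v)).trans ?_)
        norm_num
      · by_contra! hlt
        apply hxy
        have h1 : G.diam ≤ (2 : ℕ) :=
          Order.le_of_lt_add_one (by simpa using hlt)
        exact ((le_iSup (G.dist x) y).trans (le_iSup G.outEcc x)).trans h1
    · rw [ENat.card_eq_coe_fintype_card, hV]
      rfl

theorem IsRadialMoore.card_eq {V : Type*} [Fintype V] {G : MixedGraph V}
    (h : G.IsRadialMoore 2 1 2) : Fintype.card V = 11 := by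
  have := h.2.2.2
  rw [ENat.card_eq_coe_fintype_card] at this
  exact_mod_cast this

/-- If all distances from `u` are at most `3`, the status of `u` is obtained by adding up the
sizes of the complements of the balls of radius `0`, `1` and `2`. -/
theorem Nbrs.status_eq {V : Type*} [Fintype V] {G : MixedGraph V} {a b p : V → V}
    (h : G.Nbrs a b p) (hV : Fintype.card V = 11) (u : V) (h3 : ∀ v, G.dist u v ≤ (3 : ℕ))
    (m : ℕ) (hm : {v | G.dist u v ≤ (2 : ℕ)}.ncard + m = 11) :
    G.status u = (17 + m : ℕ) := by
  classical
  have hd : ∀ v, G.dist u v = ((if G.dist u v ≤ (0 : ℕ) then 0 else 1) +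
      (if G.dist u v ≤ (1 : ℕ) then 0 else 1) + (if G.dist u v ≤ (2 : ℕ) then 0 else 1) : ℕ) := by
    intro v
    obtain ⟨d, hd, hd3⟩ := ENat.le_natCast_iff.1 (h3 v)
    rw [hd]
    simp only [Nat.cast_le, Nat.cast_inj]
    interval_cases d <;> rfl
  have hc : ∀ n : ℕ, (∑ v, if G.dist u v ≤ (n : ℕ∞) then 0 else 1) +
      {v | G.dist u v ≤ (n : ℕ∞)}.ncard = 11 := by
    intro n
    rw [Set.ncard_eq_toFinset_card', ← hV, ← Finset.card_univ,
      ← Finset.card_filter_add_card_filter_not (s := Finset.univ)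
      (fun v => ¬ G.dist u v ≤ (n : ℕ∞)), Finset.card_filter]
    congr 1
    · exact Finset.sum_congr rfl fun v _ => by
        by_cases hv : G.dist u v ≤ (n : ℕ∞)
        · rw [if_pos hv, if_neg (not_not.2 hv)]
        · rw [if_neg hv, if_pos hv]
    · congr 1
      ext v
      simp
  have h0 : {v | G.dist u v ≤ (0 : ℕ)}.ncard = 1 := by
    rw [Set.ncard_eq_one]
    exact ⟨u, Set.ext fun v => (dist_le_zero G u v).trans eq_comm⟩
  have hirr : ∀ v, ¬ G.arcs.Adj v v := fun v hv => G.arcs_asymm v v hv hv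
  have e1 : a u ≠ u := fun he => G.edges.irrefl (v := u) ((h.edge u u).2 (Or.inl he.symm))
  have e2 : b u ≠ u := fun he => G.edges.irrefl (v := u) ((h.edge u u).2 (Or.inr he.symm))
  have e3 : p u ≠ u := fun he => hirr u ((h.arc u u).2 he.symm)
  have e4 : a u ≠ p u := fun he =>
    G.edges_disjoint_arcs u (a u) ((h.edge u _).2 (Or.inl rfl)) ((h.arc u _).2 he)
  have e5 : b u ≠ p u := fun he =>
    G.edges_disjoint_arcs u (b u) ((h.edge u _).2 (Or.inr rfl)) ((h.arc u _).2 he)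
  have h1 : {v | G.dist u v ≤ (1 : ℕ)}.ncard = 4 := by
    have : {v | G.dist u v ≤ (1 : ℕ)} = (({u, a u, b u, p u} : Finset V) : Set V) := by
      ext v
      simpa using h.dist_le_one u v
    rw [this, Set.ncard_coe_finset, Finset.card_insert_of_notMem, Finset.card_insert_of_notMem,
      Finset.card_pair e5]
    · simp [h.ne u, e4]
    · simp [e1.symm, e2.symm, e3.symm]
  have hs : G.status u = (∑ v, ((if G.dist u v ≤ (0 : ℕ) then 0 else 1) +
      (if G.dist u v ≤ (1 : ℕ) then 0 else 1) +
      (if G.dist u v ≤ (2 : ℕ) then 0 else 1)) : ℕ) := by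
    rw [Nat.cast_sum]
    exact Finset.sum_congr rfl fun v _ => hd v
  rw [hs, Nat.cast_inj, Finset.sum_add_distrib, Finset.sum_add_distrib]
  have c0 := hc 0
  have c1 := hc 1
  have c2 := hc 2
  omega

/-! ### Tables of a graph and the balls computed from them -/

section

/-- The binary digits at the vertices of the ball of radius one around `i`, for a graph with tables
`A`, `B` of neighbours along edges and table `P` of neighbours along arcs. -/
def ballOne (A B P i : ℕ) : ℕ :=
  Nat.lor (Nat.shiftLeft 1 i) (Nat.lor (Nat.shiftLeft 1 (look A i))
    (Nat.lor (Nat.shiftLeft 1 (look B i)) (Nat.shiftLeft 1 (look P i))))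

/-- The ball of radius `n + 1` around `i`, if the rows of `T` are the balls of radius `n`. -/
def nextBall (A B P T i : ℕ) : ℕ :=
  Nat.lor (Nat.shiftLeft 1 i) (Nat.lor (row T (look A i))
    (Nat.lor (row T (look B i)) (row T (look P i))))

/-- The matrix whose rows are the balls of radius two. -/
def balls (A B P : ℕ) : ℕ :=
  force (pack 11 (ballOne A B P) verts) fun T => pack 11 (nextBall A B P T) verts

/-- The number of vertices outside the ball that is the row `i` of `T`. -/
def deficit (T i : ℕ) : ℕ := Nat.sub 11 (popcount (row T i))

/-- The number `T` is a table of the function `f`. -/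
def Tab (T : ℕ) (f : Fin 11 → Fin 11) : Prop := ∀ i : Fin 11, look T i = f i

/-- The graph `G` has the neighbour functions `a`, `b`, `p`, with tables `A`, `B`, `P`. -/
structure Coded (A B P : ℕ) (G : MixedGraph (Fin 11)) (a b p : Fin 11 → Fin 11) : Prop
    extends Nbrs G a b p where
  tabA : Tab A a
  tabB : Tab B b
  tabP : Tab P p

variable {A B P : ℕ} {G : MixedGraph (Fin 11)} {a b p : Fin 11 → Fin 11}

theorem shiftLeft_one_lt (i : Fin 11) : Nat.shiftLeft 1 i < 2 ^ 11 := by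
  change 1 <<< (i : ℕ) < 2 ^ 11
  rw [Nat.one_shiftLeft]
  exact Nat.pow_lt_pow_right (by norm_num) i.2

theorem testBit_shiftLeft_one (i j : Fin 11) :
    (Nat.shiftLeft 1 i).testBit j = true ↔ j = i := by
  change (1 <<< (i : ℕ)).testBit j = true ↔ j = i
  rw [Nat.one_shiftLeft, Nat.testBit_two_pow, decide_eq_true_iff, Fin.ext_iff, eq_comm]

theorem testBit_lor (m n : ℕ) (j : ℕ) :
    (Nat.lor m n).testBit j = true ↔ m.testBit j = true ∨ n.testBit j = true := by
  change (m ||| n).testBit j = true ↔ _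
  rw [Nat.testBit_or, Bool.or_eq_true]

theorem lor_lt {m n : ℕ} (hm : m < 2 ^ 11) (hn : n < 2 ^ 11) : Nat.lor m n < 2 ^ 11 :=
  Nat.or_lt_two_pow hm hn

theorem Coded.ballOne_lt (h : Coded A B P G a b p) (i : Fin 11) : ballOne A B P i < 2 ^ 11 := by
  rw [ballOne, h.tabA, h.tabB, h.tabP]
  exact lor_lt (shiftLeft_one_lt _) (lor_lt (shiftLeft_one_lt _)
    (lor_lt (shiftLeft_one_lt _) (shiftLeft_one_lt _)))

theorem Coded.testBit_ballOne (h : Coded A B P G a b p) (i j : Fin 11) :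
    (ballOne A B P i).testBit j = true ↔ G.dist i j ≤ (1 : ℕ) := by
  rw [ballOne, h.tabA, h.tabB, h.tabP, h.dist_le_one]
  simp only [testBit_lor, testBit_shiftLeft_one]

theorem nextBall_lt (T : ℕ) (i : Fin 11) : nextBall A B P T i < 2 ^ 11 :=
  lor_lt (shiftLeft_one_lt _) (lor_lt (row_lt _ _) (lor_lt (row_lt _ _) (row_lt _ _)))

theorem Coded.testBit_nextBall (h : Coded A B P G a b p) {T n : ℕ}
    (hT : ∀ i j : Fin 11, (row T i).testBit j = true ↔ G.dist i j ≤ n) (i j : Fin 11) :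
    (nextBall A B P T i).testBit j = true ↔ G.dist i j ≤ (n + 1 : ℕ) := by
  rw [nextBall, h.tabA, h.tabB, h.tabP, h.dist_le_succ, @eq_comm _ i j]
  simp only [testBit_lor, testBit_shiftLeft_one, hT]

theorem Coded.testBit_balls (h : Coded A B P G a b p) (i j : Fin 11) :
    (row (balls A B P) i).testBit j = true ↔ G.dist i j ≤ (2 : ℕ) := by
  rw [balls, force_eq, row_pack_verts (forall_mem_verts.2 fun i => nextBall_lt _ i)]
  refine h.testBit_nextBall (fun i j => ?_) i j
  rw [row_pack_verts (forall_mem_verts.2 fun i => h.ballOne_lt i), h.testBit_ballOne]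

theorem Coded.row_balls_eq (h : Coded A B P G a b p) (i : Fin 11) :
    row (balls A B P) i = 2047 ↔ ∀ j, G.dist i j ≤ (2 : ℕ) := by
  rw [eq_2047_iff (row_lt _ _)]
  simp only [h.testBit_balls]

theorem Coded.nextBall_balls_eq (h : Coded A B P G a b p) (i : Fin 11) :
    nextBall A B P (balls A B P) i = 2047 ↔ ∀ j, G.dist i j ≤ (3 : ℕ) := by
  rw [eq_2047_iff (nextBall_lt _ _)]
  simp only [h.testBit_nextBall h.testBit_balls]

theorem Coded.ncard_add_deficit (h : Coded A B P G a b p) (i : Fin 11) :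
    {j | G.dist i j ≤ (2 : ℕ)}.ncard + deficit (balls A B P) i = 11 := by
  have hp : popcount (row (balls A B P) i) = {j | G.dist i j ≤ (2 : ℕ)}.ncard := by
    classical
    rw [popcount_eq _ (row_lt _ _), Set.ncard_eq_toFinset_card', Finset.card_eq_sum_ones,
      Set.toFinset_ofPred, Finset.sum_filter]
    refine Finset.sum_congr rfl fun j _ => ?_
    simp only [← h.testBit_balls]
    cases (row (balls A B P) i).testBit j <;> rfl
  have hle : {j | G.dist i j ≤ (2 : ℕ)}.ncard ≤ 11 := by
    simpa using Set.ncard_le_card {j | G.dist i j ≤ (2 : ℕ)}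
  change _ + (11 - popcount _) = 11
  omega

theorem Coded.status_eq (h : Coded A B P G a b p) (h3 : ∀ i j, G.dist i j ≤ (3 : ℕ)) (i : Fin 11) :
    G.status i = (17 + deficit (balls A B P) i : ℕ) := by
  have hm := h.ncard_add_deficit i
  -- Otherwise unification would try to evaluate the balls.
  generalize deficit (balls A B P) i = m at hm ⊢
  exact h.toNbrs.status_eq (by simp) i (h3 i) m hm

theorem mooreStatus_eq : mooreStatus 2 1 2 = 17 := by
  simp [mooreStatus, mooreLevel, Finset.sum_range_succ]

theorem statusNorm_of_status_eq {d : ℕ → ℕ} (hd : ∀ i, G.status i = (17 + d i : ℕ)) (q : ℕ) :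
    G.statusNorm 2 1 2 q = (((verts.map fun i => d i ^ q).sum : ℕ) : ℝ) ^ (1 / (q : ℝ)) := by
  have hs : (verts.map fun i => d i ^ q).sum = ∑ i : Fin 11, d i ^ q := by
    simp [verts, Fin.sum_univ_succ]
  have hv : ∀ i, |((G.status i).toNat : ℝ) - ((17 : ℕ) : ℝ)| = d i := by
    intro i
    rw [hd, ENat.toNat_natCast, Nat.cast_add, add_sub_cancel_left,
      abs_of_nonneg (Nat.cast_nonneg _)]
  rw [statusNorm, mooreStatus_eq, hs, Nat.cast_sum]
  simp only [hv, Nat.cast_pow]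

/-! ### Rooted graphs: labellings by the Moore tree of a central vertex -/

/-- The vertices are labelled along the Moore tree of depth two with root `0`. -/
structure Rooted (G : MixedGraph (Fin 11)) : Prop where
  e01 : G.edges.Adj 0 1
  e02 : G.edges.Adj 0 2
  e14 : G.edges.Adj 1 4
  e26 : G.edges.Adj 2 6
  e38 : G.edges.Adj 3 8
  e39 : G.edges.Adj 3 9
  a03 : G.arcs.Adj 0 3
  a15 : G.arcs.Adj 1 5
  a27 : G.arcs.Adj 2 7
  a3t : G.arcs.Adj 3 10

/-- The Moore tree of a vertex `v` of out-eccentricity at most two contains all eleven vertices, so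
it can be used to label them; only the order of the two neighbours `x`, `y` of `v` and of the two
neighbours `z`, `w` of `p v` is free. -/
theorem Nbrs.exists_rooted {V : Type*} [Fintype V] {G : MixedGraph V} {a b p : V → V}
    (h : G.Nbrs a b p) (hV : Fintype.card V = 11) {v x y z w : V}
    (hv : ∀ u, G.dist v u ≤ (2 : ℕ)) (hxy : ∀ u, G.edges.Adj v u ↔ u = x ∨ u = y)
    (hzw : ∀ u, G.edges.Adj (p v) u ↔ u = z ∨ u = w) :
    ∃ σ : Fin 11 ≃ V, Rooted (G.comap σ) ∧ σ 0 = v ∧ σ 1 = x ∧ σ 2 = y ∧ σ 8 = z ∧ σ 9 = w := by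
  have other : ∀ x, G.edges.Adj v x → ∃ x', ∀ u, G.edges.Adj x u ↔ u = v ∨ u = x' := by
    intro x hx
    rcases (h.edge x v).1 hx.symm with he | he
    · exact ⟨b x, fun u => by rw [h.edge, ← he]⟩
    · exact ⟨a x, fun u => by rw [h.edge, ← he, or_comm]⟩
  obtain ⟨x', hx'⟩ := other x ((hxy x).2 (Or.inl rfl))
  obtain ⟨y', hy'⟩ := other y ((hxy y).2 (Or.inr rfl))
  set f : Fin 11 → V := ![v, x, y, p v, x', p x, y', p y, z, w, p (p v)] with hf
  have hsurj : Function.Surjective f := by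
    intro u
    have hstep : ∀ w, G.dist w u ≤ (1 : ℕ) → u = w ∨ G.edges.Adj w u ∨ u = p w := by
      intro w hw
      rw [h.dist_le_one] at hw
      rw [h.edge]
      tauto
    have hu := hv u
    rw [MixedGraph.dist_le_succ] at hu
    rcases hu with rfl | ⟨t, ht, htu⟩
    · exact ⟨0, rfl⟩
    rw [Step, hxy, h.arc] at ht
    have htu := hstep t htu
    rcases ht with (rfl | rfl) | rfl
    · rw [hx'] at htu
      rcases htu with rfl | (rfl | rfl) | rfl
      exacts [⟨1, rfl⟩, ⟨0, rfl⟩, ⟨4, rfl⟩, ⟨5, rfl⟩]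
    · rw [hy'] at htu
      rcases htu with rfl | (rfl | rfl) | rfl
      exacts [⟨2, rfl⟩, ⟨0, rfl⟩, ⟨6, rfl⟩, ⟨7, rfl⟩]
    · rw [hzw] at htu
      rcases htu with rfl | (rfl | rfl) | rfl
      exacts [⟨3, rfl⟩, ⟨8, rfl⟩, ⟨9, rfl⟩, ⟨10, rfl⟩]
  have hbij : Function.Bijective f :=
    (Fintype.bijective_iff_surjective_and_card f).2 ⟨hsurj, by simp [hV]⟩
  exact ⟨Equiv.ofBijective f hbij,
    { e01 := (hxy x).2 (Or.inl rfl)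
      e02 := (hxy y).2 (Or.inr rfl)
      e14 := (hx' x').2 (Or.inr rfl)
      e26 := (hy' y').2 (Or.inr rfl)
      e38 := (hzw z).2 (Or.inl rfl)
      e39 := (hzw w).2 (Or.inr rfl)
      a03 := (h.arc _ _).2 rfl
      a15 := (h.arc _ _).2 rfl
      a27 := (h.arc _ _).2 rfl
      a3t := (h.arc _ _).2 rfl }, rfl, rfl, rfl, rfl, rfl⟩

theorem Rooted.dist_le_two (h : Rooted G) (j : Fin 11) : G.dist 0 j ≤ (2 : ℕ) := by
  have h1 : ∀ u v w, G.Step u v → G.Step v w → G.dist u w ≤ (2 : ℕ) := fun u v w huv hvw =>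
    (dist_le_iff _ _ _ _).2 ⟨2, le_rfl, v, huv, w, hvw, rfl⟩
  have h2 : ∀ u v, G.Step u v → G.dist u v ≤ (2 : ℕ) := fun u v huv =>
    (dist_le_iff _ _ _ _).2 ⟨1, by norm_num, v, huv, rfl⟩
  have s1 : G.Step 0 1 := Or.inl h.e01
  have s2 : G.Step 0 2 := Or.inl h.e02
  have s3 : G.Step 0 3 := Or.inr h.a03
  fin_cases j
  · exact (dist_le_iff _ _ _ _).2 ⟨0, by norm_num, rfl⟩
  · exact h2 _ _ s1
  · exact h2 _ _ s2
  · exact h2 _ _ s3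
  · exact h1 _ _ _ s1 (Or.inl h.e14)
  · exact h1 _ _ _ s1 (Or.inr h.a15)
  · exact h1 _ _ _ s2 (Or.inl h.e26)
  · exact h1 _ _ _ s2 (Or.inr h.a27)
  · exact h1 _ _ _ s3 (Or.inl h.e38)
  · exact h1 _ _ _ s3 (Or.inl h.e39)
  · exact h1 _ _ _ s3 (Or.inr h.a3t)

end

/-! ### Keys of rooted graphs under relabelling -/

section

/-- The vertices outside the ball of radius one around the root of a rooted graph. -/
def outer : List ℕ := [4, 5, 6, 7, 8, 9, 10]

/-- The table of the identity function. -/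
def idTab : ℕ := pack 4 (fun i => i) verts

/-- The table of the inverse of the permutation with table `S`. -/
def invTab (S : ℕ) : ℕ := sumOf (fun i => Nat.shiftLeft i (Nat.mul 4 (look S i))) verts

/-- The part of the key that describes the edges: the neighbourhoods of the outer vertices, after
relabelling by the permutation with table `S` and inverse table `I`. -/
def keyE (A B S I : ℕ) : ℕ :=
  pack 11 (fun i => force (look S i) fun x =>
    Nat.add (Nat.shiftLeft 1 (look I (look A x))) (Nat.shiftLeft 1 (look I (look B x)))) outer

/-- The part of the key that describes the arcs. -/
def keyP (P S I : ℕ) : ℕ := pack 4 (fun i => look I (look P (look S i))) outer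

/-- The table of the labelling by the Moore tree with root `v`, if `x`, `y` are the neighbours of
`v`, and `z`, `w` those of the head of the arc from `v`.  The second neighbour of `x` is found by
subtracting `v` from the sum of both. -/
def labTab (A B P v x y z w : ℕ) : ℕ :=
  pack 4 (fun n => n) [v, x, y, look P v, Nat.sub (Nat.add (look A x) (look B x)) v, look P x,
    Nat.sub (Nat.add (look A y) (look B y)) v, look P y, z, w, look P (look P v)]

/-- `f` holds for the four labellings by the Moore tree with root `v`. -/
def allLabs (A B P v : ℕ) (f : ℕ → Bool) : Bool :=
  force (look A v) fun x => force (look B v) fun y =>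
  force (look A (look P v)) fun z => force (look B (look P v)) fun w =>
  band (force (labTab A B P v x y z w) f) (band (force (labTab A B P v y x z w) f)
   (band (force (labTab A B P v x y w z) f) (force (labTab A B P v y x w z) f)))

/-- The relabelling with table `S` does not lead to a smaller key than `(KE, KP)`. -/
def keyLe (A B P KE KP S : ℕ) : Bool :=
  force (invTab S) fun I => force (keyE A B S I) fun k =>
    bor (Nat.ble (Nat.succ KE) k) (band (Nat.beq KE k) (Nat.ble KP (keyP P S I)))

variable {A B P : ℕ} {G : MixedGraph (Fin 11)} {a b p : Fin 11 → Fin 11}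

theorem mem_outer {i : ℕ} : i ∈ outer ↔ 4 ≤ i ∧ i < 11 := by
  simp only [outer, List.mem_cons, List.not_mem_nil, or_false]
  omega

theorem forall_mem_outer {q : ℕ → Prop} :
    (∀ i ∈ outer, q i) ↔ ∀ i : Fin 11, 4 ≤ i → q i := by
  refine ⟨fun h i hi => h i (mem_outer.2 ⟨hi, i.2⟩), fun h i hi => ?_⟩
  rw [mem_outer] at hi
  exact h ⟨i, hi.2⟩ (Fin.mk_le_mk.2 hi.1)

theorem tab_idTab : Tab idTab (Equiv.refl (Fin 11)) :=
  look_pack_verts (forall_mem_verts.2 fun i => by omega)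

theorem pack_verts_eq_sum (w : ℕ) (f : ℕ → ℕ) :
    pack w f verts = ∑ j : Fin 11, f j * 2 ^ (w * j) := by
  have h : pack w f [] = 0 := rfl
  simp only [verts, pack_cons, h, Fin.sum_univ_succ, Fin.val_succ, Fin.val_zero]
  simp only [Finset.univ_eq_empty, Finset.sum_empty, mul_add, pow_add, mul_zero, pow_zero,
    mul_one, zero_add, add_zero]
  ring

theorem tab_invTab {S : ℕ} {σ : Equiv.Perm (Fin 11)} (hS : Tab S σ) : Tab (invTab S) σ.symm := by
  let g : ℕ → ℕ := fun j => if h : j < 11 then σ.symm ⟨j, h⟩ else 0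
  have hg : ∀ j : Fin 11, g j = σ.symm j := fun j => dif_pos j.2
  have h : invTab S = pack 4 g verts := by
    rw [pack_verts_eq_sum, ← Equiv.sum_comp σ, invTab, sumOf_eq]
    have h1 : ∀ i : Fin 11,
        Nat.shiftLeft i (Nat.mul 4 (look S i)) = g (σ i) * 2 ^ (4 * (σ i : ℕ)) := by
      intro i
      rw [hS, hg, σ.symm_apply_apply]
      exact Nat.shiftLeft_eq _ _
    rw [← Finset.sum_congr rfl fun i _ => h1 i]
    simp [verts, Fin.sum_univ_succ]
  intro i
  rw [h, look_pack_verts _ i, hg]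
  rw [forall_mem_verts]
  intro j
  rw [hg]
  omega

/-- The number with binary digits at `x` and `y`. -/
def pairMask (x y : Fin 11) : ℕ := 2 ^ (x : ℕ) + 2 ^ (y : ℕ)

theorem testBit_pairMask : ∀ x y j : Fin 11, x ≠ y →
    ((pairMask x y).testBit j = true ↔ j = x ∨ j = y) := by
  unfold pairMask
  decide +kernel

theorem pairMask_lt : ∀ x y : Fin 11, x ≠ y → pairMask x y < 2 ^ 11 := by
  unfold pairMask
  decide +kernel

theorem pairMask_eq {x y x' y' : Fin 11} (hne : x' ≠ y')
    (h : ∀ j, j = x' ∨ j = y' ↔ j = x ∨ j = y) : pairMask x y = pairMask x' y' := by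
  rcases (h x').1 (Or.inl rfl) with h1 | h1 <;> rcases (h y').1 (Or.inr rfl) with h2 | h2
  · exact absurd (h1.trans h2.symm) hne
  · rw [h1, h2]
  · rw [h1, h2, pairMask, pairMask, add_comm]
  · exact absurd (h1.trans h2.symm) hne

theorem keyE_digit {σ τ : Fin 11 → Fin 11} {S I : ℕ} (h : Coded A B P G a b p) (hS : Tab S σ)
    (hI : Tab I τ) (i : Fin 11) :
    (force (look S i) fun x => Nat.add (Nat.shiftLeft 1 (look I (look A x)))
      (Nat.shiftLeft 1 (look I (look B x)))) = pairMask (τ (a (σ i))) (τ (b (σ i))) := by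
  rw [force_eq, hS, h.tabA, h.tabB, hI, hI]
  change 1 <<< _ + 1 <<< _ = _
  rw [Nat.one_shiftLeft, Nat.one_shiftLeft]
  rfl

theorem keyP_digit {σ τ : Fin 11 → Fin 11} {S I : ℕ} (h : Coded A B P G a b p) (hS : Tab S σ)
    (hI : Tab I τ) (i : Fin 11) : look I (look P (look S i)) = τ (p (σ i)) := by
  rw [hS, h.tabP, hI]

/-- The key computed from the tables of `G` and a relabelling is the key of the relabelled
graph. -/
theorem Coded.keys_comap {A' B' P' S I : ℕ} {a' b' p' : Fin 11 → Fin 11} {σ : Equiv.Perm (Fin 11)}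
    (h : Coded A B P G a b p) (h' : Coded A' B' P' (G.comap σ) a' b' p') (hS : Tab S σ)
    (hI : Tab I σ.symm) :
    keyE A B S I = keyE A' B' idTab idTab ∧ keyP P S I = keyP P' idTab idTab := by
  constructor
  · refine pack_congr (forall_mem_outer.2 fun i _ => ?_)
    rw [keyE_digit h hS hI, keyE_digit h' tab_idTab tab_idTab]
    refine pairMask_eq (h'.ne i) fun j => ?_
    refine (h'.edge i j).symm.trans ((h.edge (σ i) (σ j)).trans ?_)
    rw [Equiv.eq_symm_apply, Equiv.eq_symm_apply]
  · refine pack_congr (forall_mem_outer.2 fun i _ => ?_)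
    rw [keyP_digit h hS hI, keyP_digit h' tab_idTab tab_idTab]
    congr 1
    refine (h'.arc i _).1 ((h.arc (σ i) _).2 ?_)
    exact σ.apply_symm_apply _

theorem Rooted.edge_iff (hr : Rooted G) (h : Coded A B P G a b p) : ∀ i j : Fin 11, i < 4 →
    (G.edges.Adj i j ↔ (i, j) ∈ [((0 : Fin 11), (1 : Fin 11)), (0, 2), (1, 0), (1, 4), (2, 0),
      (2, 6), (3, 8), (3, 9)]) := by
  have key : ∀ i x y : Fin 11, x ≠ y → G.edges.Adj i x → G.edges.Adj i y →
      ∀ j, G.edges.Adj i j ↔ j = x ∨ j = y := by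
    intro i x y hxy hx hy j
    rw [h.edge] at hx hy ⊢
    rcases hx with rfl | rfl <;> rcases hy with rfl | rfl
    · exact absurd rfl hxy
    · rfl
    · exact or_comm
    · exact absurd rfl hxy
  have k0 := key 0 1 2 (by decide) hr.e01 hr.e02
  have k1 := key 1 0 4 (by decide) hr.e01.symm hr.e14
  have k2 := key 2 0 6 (by decide) hr.e02.symm hr.e26
  have k3 := key 3 8 9 (by decide) hr.e38 hr.e39
  intro i j hi
  match i, hi with
  | 0, _ => rw [k0]; revert j; decide
  | 1, _ => rw [k1]; revert j; decide
  | 2, _ => rw [k2]; revert j; decide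
  | 3, _ => rw [k3]; revert j; decide

theorem Rooted.p_eq (hr : Rooted G) (h : Coded A B P G a b p) :
    p 0 = 3 ∧ p 1 = 5 ∧ p 2 = 7 ∧ p 3 = 10 :=
  ⟨((h.arc _ _).1 hr.a03).symm, ((h.arc _ _).1 hr.a15).symm, ((h.arc _ _).1 hr.a27).symm,
    ((h.arc _ _).1 hr.a3t).symm⟩

/-- The key determines a rooted graph, as the labelling already determines the edges and arcs at the
vertices `0` to `3`. -/
theorem Rooted.eq_of_keys_eq {A' B' P' : ℕ} {a' b' p' : Fin 11 → Fin 11}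
    {G' : MixedGraph (Fin 11)} (hr : Rooted G) (hr' : Rooted G') (h : Coded A B P G a b p)
    (h' : Coded A' B' P' G' a' b' p') (hE : keyE A B idTab idTab = keyE A' B' idTab idTab)
    (hP : keyP P idTab idTab = keyP P' idTab idTab) : G = G' := by
  have hE := pack_inj (forall_mem_outer.2 fun i _ => by
    rw [keyE_digit h tab_idTab tab_idTab]
    exact pairMask_lt _ _ (h.ne _)) (forall_mem_outer.2 fun i _ => by
    rw [keyE_digit h' tab_idTab tab_idTab]
    exact pairMask_lt _ _ (h'.ne _)) hE
  have hP := pack_inj (forall_mem_outer.2 fun i _ => by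
    rw [keyP_digit h tab_idTab tab_idTab]
    exact (Fin.is_lt _).trans (by norm_num)) (forall_mem_outer.2 fun i _ => by
    rw [keyP_digit h' tab_idTab tab_idTab]
    exact (Fin.is_lt _).trans (by norm_num)) hP
  rw [forall_mem_outer] at hE hP
  ext i j
  · by_cases hi : i < 4
    · rw [hr.edge_iff h i j hi, hr'.edge_iff h' i j hi]
    · have := hE i (not_lt.1 hi)
      rw [keyE_digit h tab_idTab tab_idTab, keyE_digit h' tab_idTab tab_idTab] at this
      rw [h.edge, h'.edge, ← testBit_pairMask _ _ _ (h.ne i), ← testBit_pairMask _ _ _ (h'.ne i)]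
      rw [show pairMask (a i) (b i) = pairMask (a' i) (b' i) from this]
  · rw [h.arc, h'.arc]
    suffices p i = p' i by rw [this]
    by_cases hi : i < 4
    · obtain ⟨c0, c1, c2, c3⟩ := hr.p_eq h
      obtain ⟨d0, d1, d2, d3⟩ := hr'.p_eq h'
      match i, hi with
      | 0, _ => rw [c0, d0]
      | 1, _ => rw [c1, d1]
      | 2, _ => rw [c2, d2]
      | 3, _ => rw [c3, d3]
    · have := hP i (not_lt.1 hi)
      rw [keyP_digit h tab_idTab tab_idTab, keyP_digit h' tab_idTab tab_idTab] at this
      exact Fin.ext this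

/-- A labelling that makes the graph rooted is determined by its values at `0`, `1`, `2`, `8` and
`9`. -/
theorem Coded.tab_labTab (h : Coded A B P G a b p) {σ : Equiv.Perm (Fin 11)}
    (hr : Rooted (G.comap σ)) : Tab (labTab A B P (σ 0) (σ 1) (σ 2) (σ 8) (σ 9)) σ := by
  have harc : ∀ i j, (G.comap σ).arcs.Adj i j → p (σ i) = σ j := fun i j hij =>
    ((h.arc _ _).1 hij).symm
  have hother : ∀ i j, (G.comap σ).edges.Adj 0 i → (G.comap σ).edges.Adj i j → j ≠ 0 →
      Nat.sub (Nat.add (look A (σ i)) (look B (σ i))) (σ 0) = σ j := by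
    intro i j hi hj hne
    have h0 := (h.edge (σ i) (σ 0)).1 hi.symm
    have h1 := (h.edge (σ i) (σ j)).1 hj
    have hne : σ j ≠ σ 0 := fun he => hne (σ.injective he)
    rw [h.tabA, h.tabB]
    change (a (σ i) : ℕ) + b (σ i) - σ 0 = σ j
    rcases h0 with h0 | h0 <;> rcases h1 with h1 | h1
    · exact absurd (h1.trans h0.symm) hne
    · rw [h0, h1]
      omega
    · rw [h0, h1]
      omega
    · exact absurd (h1.trans h0.symm) hne
  intro i
  rw [labTab, hother 1 4 hr.e01 hr.e14 (by decide), hother 2 6 hr.e02 hr.e26 (by decide),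
    h.tabP, h.tabP, h.tabP, harc _ _ hr.a03, harc _ _ hr.a15, harc _ _ hr.a27, h.tabP,
    harc _ _ hr.a3t, look_pack_list _ i (by simp)]
  · fin_cases i <;> rfl
  · simp only [List.mem_cons, List.not_mem_nil, or_false]
    intro x hx
    rcases hx with rfl | rfl | rfl | rfl | rfl | rfl | rfl | rfl | rfl | rfl | rfl <;> omega

/-- The four labellings considered by `allLabs` are those that make the graph rooted. -/
theorem Coded.allLabs_iff (h : Coded A B P G a b p) {v : Fin 11}
    (hv : ∀ u, G.dist v u ≤ (2 : ℕ)) (f : ℕ → Bool) : allLabs A B P v f = true ↔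
      ∀ σ : Equiv.Perm (Fin 11), σ 0 = v → Rooted (G.comap σ) →
        f (labTab A B P (σ 0) (σ 1) (σ 2) (σ 8) (σ 9)) = true := by
  have hal : allLabs A B P v f = true ↔
      f (labTab A B P v (a v) (b v) (a (p v)) (b (p v))) = true ∧
      f (labTab A B P v (b v) (a v) (a (p v)) (b (p v))) = true ∧
      f (labTab A B P v (a v) (b v) (b (p v)) (a (p v))) = true ∧
      f (labTab A B P v (b v) (a v) (b (p v)) (a (p v))) = true := by
    simp only [allLabs, force_eq, band_eq_true, h.tabA v, h.tabB v, h.tabP v, h.tabA (p v),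
      h.tabB (p v)]
  rw [hal]
  constructor
  · rintro ⟨f1, f2, f3, f4⟩ σ rfl hr
    have hne : ∀ i j : Fin 11, i ≠ j → σ i ≠ σ j := fun i j hij he => hij (σ.injective he)
    have hp : p (σ 0) = σ 3 := ((h.arc _ _).1 hr.a03).symm
    rw [hp] at f1 f2 f3 f4
    have pair : ∀ u x y, x ≠ y → G.edges.Adj u x → G.edges.Adj u y →
        (x = a u ∧ y = b u) ∨ (x = b u ∧ y = a u) := by
      intro u x y hxy hx hy
      rcases (h.edge _ _).1 hx with h1 | h1 <;> rcases (h.edge _ _).1 hy with h2 | h2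
      · exact absurd (h1.trans h2.symm) hxy
      · exact Or.inl ⟨h1, h2⟩
      · exact Or.inr ⟨h1, h2⟩
      · exact absurd (h1.trans h2.symm) hxy
    rcases pair _ _ _ (hne 1 2 (by decide)) hr.e01 hr.e02 with ⟨h1, h2⟩ | ⟨h1, h2⟩ <;>
      rcases pair _ _ _ (hne 8 9 (by decide)) hr.e38 hr.e39 with ⟨h3, h4⟩ | ⟨h3, h4⟩ <;>
      rw [h1, h2, h3, h4]
    exacts [f1, f3, f2, f4]
  · intro hf
    have main : ∀ x y z w, (∀ u, G.edges.Adj v u ↔ u = x ∨ u = y) →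
        (∀ u, G.edges.Adj (p v) u ↔ u = z ∨ u = w) → f (labTab A B P v x y z w) = true := by
      intro x y z w hxy hzw
      obtain ⟨σ, hr, rfl, rfl, rfl, rfl, rfl⟩ := h.toNbrs.exists_rooted (by simp) hv hxy hzw
      exact hf σ rfl hr
    exact ⟨main _ _ _ _ (h.edge _) (h.edge _),
      main _ _ _ _ (fun u => (h.edge _ u).trans or_comm) (h.edge _),
      main _ _ _ _ (h.edge _) (fun u => (h.edge _ u).trans or_comm),
      main _ _ _ _ (fun u => (h.edge _ u).trans or_comm) (fun u => (h.edge _ u).trans or_comm)⟩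

theorem keyLe_iff (KE KP S : ℕ) : keyLe A B P KE KP S = true ↔
    toLex (KE, KP) ≤ toLex (keyE A B S (invTab S), keyP P S (invTab S)) := by
  rw [Prod.Lex.toLex_le_toLex]
  simp only [keyLe, force_eq, bor_eq_true, band_eq_true, Nat.beq_eq, Nat.ble_eq,
    Nat.succ_le_iff]

end

/-! ### The search -/

/-- Two rows `(i, x, y)` and `(j, x', y')`, saying that the neighbours of `i` are `x`, `y` and that
those of `j` are `x'`, `y'`, agree on whether `i` and `j` are adjacent. -/
def compat (r s : ℕ × ℕ × ℕ) : Bool :=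
  (Nat.beq s.1 r.2.1 || Nat.beq s.1 r.2.2) == (Nat.beq r.1 s.2.1 || Nat.beq r.1 s.2.2)

/-- The rows of the root and its out-neighbours in a rooted graph. -/
def innerRows : List (ℕ × ℕ × ℕ) := [(0, 1, 2), (1, 0, 4), (2, 0, 6), (3, 8, 9)]

/-- The rows of the vertex `i` that agree with the inner rows. -/
def rowOptions (i : ℕ) : List (ℕ × ℕ × ℕ) :=
  (verts.flatMap fun x => verts.map fun y => (i, x, y)).filter fun r =>
    Nat.blt r.2.1 r.2.2 && !Nat.beq r.2.1 i && !Nat.beq r.2.2 i && innerRows.all (compat r)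

/-- All choices of one row from each list that agree with each other and with the rows chosen
before. -/
def chooseRows : List (List (ℕ × ℕ × ℕ)) → List (ℕ × ℕ × ℕ) → List (List (ℕ × ℕ × ℕ))
  | [], acc => [acc]
  | opts :: rest, acc =>
    (opts.filter fun r => acc.all (compat r)).flatMap fun r => chooseRows rest (r :: acc)

/-- The tables `(A, B)` of all 2-regular graphs that contain the edges of a rooted graph at the
vertices `0` to `3`, and in which the row of the vertex `10` is `r`. -/
def edgeTables (r : ℕ × ℕ × ℕ) : List (ℕ × ℕ) :=
  (chooseRows ([9, 8, 7, 6, 5, 4].map rowOptions) [r]).map fun l =>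
      (pack 4 (fun x => x) ((innerRows ++ l).map fun r => r.2.1),
        pack 4 (fun x => x) ((innerRows ++ l).map fun r => r.2.2))

/-- An arc from `i` to `t` would be a loop or parallel to an edge. -/
def badArc (A B i t : ℕ) : Bool :=
  bor (Nat.beq t i) (bor (Nat.beq t (look A i)) (Nat.beq t (look B i)))

/-- All ways to assign the available heads to the given tails, without bad arcs.  Heads are put in
front of the list. -/
def arcLists (bad : ℕ → ℕ → Bool) : List ℕ → List ℕ → List ℕ → List (List ℕ)
  | [], _, acc => [acc]
  | i :: tails, heads, acc => heads.flatMap fun t =>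
      if bad i t = true then [] else arcLists bad tails (heads.erase t) (t :: acc)

/-- The sum of `f` over the lists in `arcLists`, each packed into a number. -/
def arcSum (bad : ℕ → ℕ → Bool) (f : ℕ → ℕ) (tails : List ℕ) : List ℕ → ℕ → ℕ :=
  List.rec (fun _ n => f n) (fun i _ ih heads n =>
    sumOf (fun t => sel (bad i t) 0
      (force (Nat.add t (Nat.shiftLeft n 4)) fun n' => ih (remove t heads) n')) heads) tails

/-- The outer vertices, as tails of arcs, in the order in which they are assigned heads. -/
def tails : List ℕ := [10, 9, 8, 7, 6, 5, 4]

/-- The vertices that are not the head of an arc of the Moore tree. -/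
def heads : List ℕ := [0, 1, 2, 4, 6, 8, 9]

/-- The table of arcs that continues the arcs `0 → 3`, `1 → 5`, `2 → 7`, `3 → 10` of the Moore
tree. -/
def arcTable (n : ℕ) : ℕ := Nat.add 0xA753 (Nat.shiftLeft n 16)

/-- No two of the arcs are opposite. -/
def noTwoCycle (P : ℕ) : Bool :=
  allOf (fun i => force (look P i) fun j => sel (Nat.beq (look P j) i) false true) outer

/-- All distances are at most `3`, where the rows of `T` are the balls of radius two. -/
def diamLe (A B P T : ℕ) : Bool := allOf (fun i => Nat.beq (nextBall A B P T i) 2047) verts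

/-- No relabelling by the Moore tree of a central vertex leads to a smaller key. -/
def isLeast (A B P T KE KP : ℕ) : Bool :=
  allOf (fun v => sel (Nat.beq (row T v) 2047) (allLabs A B P v (keyLe A B P KE KP)) true) verts

/-- No relabelling by the Moore tree of the root leads to a smaller key of the edges.  Of the arcs,
only those of the Moore tree matter here. -/
def edgesLeast (A B KE : ℕ) : Bool :=
  allLabs A B (arcTable 0) 0 fun S => force (invTab S) fun I => Nat.ble KE (keyE A B S I)

/-- The tables of the rooted graph of least key that is isomorphic to the first graph. -/
def code₁ : ℕ × ℕ × ℕ := (0x43352718001, 0x6578a9a9642, 0x124968a753)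

/-- The tables of the rooted graph of least key that is isomorphic to the second graph. -/
def code₂ : ℕ × ℕ × ℕ := (0x43352718001, 0x6578a9a9642, 0x1024968a753)

/-- The triple consists of the given tables. -/
def isCode (c : ℕ × ℕ × ℕ) (A B P : ℕ) : Bool :=
  band (Nat.beq A c.1) (band (Nat.beq B c.2.1) (Nat.beq P c.2.2))

/-- The sum of the deficits is more than `8`, or it is `8` and the sum of their squares is more than
`10`, or it is `8` and the graph is one of the two exceptional ones. -/
def far (A B P T : ℕ) : Bool :=
  force (sumOf (deficit T) verts) fun d => band (Nat.ble 8 d) (bor (Nat.ble 9 d)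
    (bor (Nat.ble 11 (sumOf (fun i => force (deficit T i) fun e => Nat.mul e e) verts))
      (bor (isCode code₁ A B P) (isCode code₂ A B P))))

/-- The weight of a graph: `0` if it is not the representative of its isomorphism class, `1` if it
is, and a number larger than the number of all classes if it is but is not far. -/
def weight (A B KE P : ℕ) : ℕ :=
  sel (noTwoCycle P) (force (balls A B P) fun T =>
    sel (diamLe A B P T) (force (keyP P idTab idTab) fun KP =>
      sel (isLeast A B P T KE KP) (sel (far A B P T) 1 10000) 0) 0) 0

/-- The total weight of the graphs with the given edges. -/
def edgeWeight (A B : ℕ) : ℕ :=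
  force (keyE A B idTab idTab) fun KE => sel (edgesLeast A B KE)
    (arcSum (badArc A B) (fun n => force (arcTable n) fun P => weight A B KE P) tails heads 0) 0

/-- The total weight of the graphs in which the row of the vertex `10` is `r`. -/
def totalWeight (r : ℕ × ℕ × ℕ) : ℕ :=
  sumOf (fun t : ℕ × ℕ => force t.1 fun A => force t.2 fun B => edgeWeight A B) (edgeTables r)

/-- The tables of the rooted graphs with these parameters, and also of some graphs with opposite
arcs. -/
def rootedTables : List (ℕ × ℕ × ℕ) :=
  ((rowOptions 10).flatMap edgeTables).flatMap fun t =>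
    (arcLists (badArc t.1 t.2) tails heads []).map fun l =>
      (t.1, t.2, arcTable (pack 4 (fun x => x) l))

/-- The key of the edges of a graph with its own labelling. -/
def ownKeyE (c : ℕ × ℕ × ℕ) : ℕ := keyE c.1 c.2.1 idTab idTab

/-- The key of the arcs of a graph with its own labelling. -/
def ownKeyP (c : ℕ × ℕ × ℕ) : ℕ := keyP c.2.2 idTab idTab

/-- The matrix of the balls of radius two. -/
def ownBalls (c : ℕ × ℕ × ℕ) : ℕ := balls c.1 c.2.1 c.2.2

/-- The graph represents its isomorphism class: it has no opposite arcs, its distances are at most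
`3`, and its key is least. -/
def accepted (c : ℕ × ℕ × ℕ) : Bool :=
  edgesLeast c.1 c.2.1 (ownKeyE c) && noTwoCycle c.2.2 &&
    diamLe c.1 c.2.1 c.2.2 (ownBalls c) &&
      isLeast c.1 c.2.1 c.2.2 (ownBalls c) (ownKeyE c) (ownKeyP c)

/-- `far`, as a property of the triple of tables. -/
def isFar (c : ℕ × ℕ × ℕ) : Bool := far c.1 c.2.1 c.2.2 (ownBalls c)

/-! ### Correctness of the search -/

theorem mem_chooseRows {q : ℕ × ℕ × ℕ → Prop} (hq : ∀ r s, q r → q s → compat r s = true)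
    {opts : List (List (ℕ × ℕ × ℕ))} {rs acc : List (ℕ × ℕ × ℕ)}
    (h : List.Forall₂ (fun o r => r ∈ o ∧ q r) opts rs) (hacc : ∀ r ∈ acc, q r) :
    rs.reverse ++ acc ∈ chooseRows opts acc := by
  induction h generalizing acc with
  | nil => simp [chooseRows]
  | @cons o r opts rs hr _ ih =>
    rw [chooseRows, List.mem_flatMap]
    refine ⟨r, ?_, ?_⟩
    · rw [List.mem_filter, List.all_eq_true]
      exact ⟨hr.1, fun s hs => hq r s hr.2 (hacc s hs)⟩
    · rw [List.reverse_cons, List.append_assoc, List.singleton_append]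
      exact ih (List.forall_mem_cons.2 ⟨hr.2, hacc⟩)

theorem mem_arcLists {bad : ℕ → ℕ → Bool} {tails heads acc l : List ℕ}
    (hlen : heads.length = tails.length) : l ∈ arcLists bad tails heads acc ↔
      ∃ us, us.Perm heads ∧ (∀ x ∈ tails.zip us, bad x.1 x.2 = false) ∧ l = us.reverse ++ acc := by
  induction tails generalizing heads acc with
  | nil =>
    rw [List.length_eq_zero_iff.1 hlen]
    simp [arcLists]
  | cons i tails ih =>
    rw [arcLists, List.mem_flatMap]
    constructor
    · rintro ⟨t, ht, hl⟩
      cases hb : bad i t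
      · rw [if_neg (by simp [hb]), ih (by rw [List.length_erase_of_mem ht, hlen]; rfl)] at hl
        obtain ⟨us, h1, h2, rfl⟩ := hl
        refine ⟨t :: us, (List.cons_perm_iff_perm_erase.2 ⟨ht, h1⟩), ?_, by simp⟩
        rw [List.zip_cons_cons, List.forall_mem_cons]
        exact ⟨hb, h2⟩
      · simp [hb] at hl
    · rintro ⟨us, h1, h2, rfl⟩
      cases us with
      | nil => simp [← h1.length_eq] at hlen
      | cons t us =>
        rw [List.zip_cons_cons, List.forall_mem_cons] at h2
        obtain ⟨ht, h1⟩ := List.cons_perm_iff_perm_erase.1 h1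
        refine ⟨t, ht, ?_⟩
        have hb : bad i t = false := h2.1
        rw [if_neg (by simp [hb]), ih (by rw [List.length_erase_of_mem ht, hlen]; rfl)]
        exact ⟨us, h1, h2.2, by simp⟩

theorem suffix_of_mem_arcLists {bad : ℕ → ℕ → Bool} {tails heads acc l : List ℕ}
    (h : l ∈ arcLists bad tails heads acc) : ∃ ts, l = ts ++ acc ∧ ts.length = tails.length := by
  induction tails generalizing heads acc with
  | nil => exact ⟨[], by simpa [arcLists] using h, rfl⟩
  | cons i tails ih =>
    rw [arcLists, List.mem_flatMap] at h
    obtain ⟨t, -, hl⟩ := h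
    split_ifs at hl
    · simp at hl
    · obtain ⟨ts, rfl, h2⟩ := ih hl
      exact ⟨ts ++ [t], by simp, by simp [h2]⟩

theorem nodup_arcLists {bad : ℕ → ℕ → Bool} {tails heads acc : List ℕ} (hh : heads.Nodup) :
    (arcLists bad tails heads acc).Nodup := by
  induction tails generalizing heads acc with
  | nil => simp [arcLists]
  | cons i tails ih =>
    rw [arcLists, List.nodup_flatMap]
    constructor
    · intro t _
      split_ifs
      · exact List.nodup_nil
      · exact ih (hh.erase t)
    · refine hh.imp fun {s t} hst l hs ht => hst ?_
      dsimp only at hs ht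
      split_ifs at hs ht
      · simp at hs
      · simp at hs
      · simp at ht
      · obtain ⟨xs, rfl, h1⟩ := suffix_of_mem_arcLists hs
        obtain ⟨ys, he, h2⟩ := suffix_of_mem_arcLists ht
        have := (List.append_inj he (h1.trans h2.symm)).2
        exact (List.cons_eq_cons.1 this).1

theorem sum_map_flatMap {α β : Type*} (f : β → ℕ) (g : α → List β) (l : List α) :
    ((l.flatMap g).map f).sum = (l.map fun x => ((g x).map f).sum).sum := by
  induction l with
  | nil => rfl
  | cons x l ih => simp [List.flatMap_cons, ih]

theorem arcSum_eq (bad : ℕ → ℕ → Bool) (f : ℕ → ℕ) (tails heads acc : List ℕ) :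
    arcSum bad f tails heads (pack 4 (fun x => x) acc) =
      ((arcLists bad tails heads acc).map fun l => f (pack 4 (fun x => x) l)).sum := by
  induction tails generalizing heads acc with
  | nil => simp [arcLists, arcSum]
  | cons i tails ih =>
    rw [arcLists, sum_map_flatMap]
    change sumOf _ heads = _
    rw [sumOf_eq]
    congr 1
    refine List.map_congr_left fun t _ => ?_
    rw [sel_eq, force_eq, remove_eq]
    split_ifs
    · rfl
    · exact ih (heads.erase t) (t :: acc)

theorem arcTable_pack (l : List ℕ) :
    arcTable (pack 4 (fun x => x) l) = pack 4 (fun x => x) (3 :: 5 :: 7 :: 10 :: l) := by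
  change 0xA753 + (pack 4 (fun x => x) l) <<< 16 = _
  simp only [pack_cons, Nat.shiftLeft_eq]
  ring

theorem pack_look_list {l : List ℕ} (hlen : l.length = 11) (hl : ∀ x ∈ l, x < 16) :
    pack 4 (look (pack 4 (fun x => x) l)) verts = pack 4 (fun x => x) l := by
  have h : ∀ (f : ℕ → ℕ) (m : List ℕ), pack 4 f m = pack 4 (fun x => x) (m.map f) := by
    intro f m
    induction m with
    | nil => rfl
    | cons i m ih => rw [List.map_cons, pack_cons, pack_cons, ih]
  rw [h]
  congr 1
  refine List.ext_getElem (by simp [hlen, verts]) fun n h1 h2 => ?_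
  rw [List.getElem_map, ← look_pack_list hl n h2]
  congr 1
  exact verts_getElem ⟨n, hlen ▸ h2⟩

/-- The conditions that make `(A, B)` the tables of a 2-regular graph that contains the edges at the
vertices `0` to `3` of a rooted graph; the digits determine the tables. -/
def EdgeSpec (t : ℕ × ℕ) : Prop :=
  (∀ i : Fin 11, look t.1 i < look t.2 i ∧ look t.2 i < 11 ∧ look t.1 i ≠ i ∧ look t.2 i ≠ i ∧
    (look t.1 (look t.1 i) = i ∨ look t.2 (look t.1 i) = i) ∧
    (look t.1 (look t.2 i) = i ∨ look t.2 (look t.2 i) = i)) ∧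
  (look t.1 0 = 1 ∧ look t.2 0 = 2 ∧ look t.2 1 = 4 ∧ look t.2 2 = 6 ∧ look t.1 3 = 8 ∧
    look t.2 3 = 9) ∧
  pack 4 (look t.1) verts = t.1 ∧ pack 4 (look t.2) verts = t.2

theorem edgeSpec_of_mem : ∀ t ∈ (rowOptions 10).flatMap edgeTables, EdgeSpec t := by
  unfold EdgeSpec
  decide +kernel

theorem nodup_edgeTables : ((rowOptions 10).flatMap edgeTables).Nodup := by
  decide +kernel

/-! ### Tables and rooted graphs -/

section

variable {G : MixedGraph (Fin 11)} {a b p : Fin 11 → Fin 11}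

theorem length_heads : heads.length = tails.length := rfl

theorem mem_rootedTables {c : ℕ × ℕ × ℕ} : c ∈ rootedTables ↔
    ∃ t ∈ (rowOptions 10).flatMap edgeTables, ∃ us : List ℕ, us.Perm heads ∧
      (∀ x ∈ tails.zip us, badArc t.1 t.2 x.1 x.2 = false) ∧
      c = (t.1, t.2, pack 4 (fun x => x) (3 :: 5 :: 7 :: 10 :: us.reverse)) := by
  rw [rootedTables, List.mem_flatMap]
  refine exists_congr fun t => and_congr_right fun _ => ?_
  rw [List.mem_map]
  constructor
  · rintro ⟨l, hl, rfl⟩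
    obtain ⟨us, h1, h2, rfl⟩ := (mem_arcLists length_heads).1 hl
    exact ⟨us, h1, h2, by rw [arcTable_pack, List.append_nil]⟩
  · rintro ⟨us, h1, h2, rfl⟩
    exact ⟨us.reverse, (mem_arcLists length_heads).2 ⟨us, h1, h2, by rw [List.append_nil]⟩,
      by rw [arcTable_pack]⟩

theorem badArc_eq_false {A B i t : ℕ} :
    badArc A B i t = false ↔ t ≠ i ∧ t ≠ look A i ∧ t ≠ look B i := by
  rw [← Bool.not_eq_true, badArc, bor_eq_true, bor_eq_true, Nat.beq_eq, Nat.beq_eq, Nat.beq_eq]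
  tauto

theorem noTwoCycle_iff {P : ℕ} : noTwoCycle P = true ↔
    ∀ i : Fin 11, 4 ≤ i → look P (look P i) ≠ i := by
  rw [noTwoCycle, allOf_eq_true, forall_mem_outer]
  simp only [force_eq, sel_eq, Nat.beq_eq]
  refine forall₂_congr fun i _ => ?_
  split_ifs with h <;> simp [h]

/-- The heads of the arcs from `0` to `3` together with the other heads are all the vertices. -/
theorem perm_verts {us : List ℕ} (h : us.Perm heads) :
    (3 :: 5 :: 7 :: 10 :: us.reverse).Perm verts := by
  have h' : (3 :: 5 :: 7 :: 10 :: us.reverse).Perm (3 :: 5 :: 7 :: 10 :: heads) :=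
    (((((List.reverse_perm us).trans h).cons 10).cons 7).cons 5).cons 3
  exact h'.trans (by decide)

theorem exists_eq_of_length_eq_seven : ∀ {l : List ℕ}, l.length = 7 →
    ∃ x₁ x₂ x₃ x₄ x₅ x₆ x₇, l = [x₁, x₂, x₃, x₄, x₅, x₆, x₇]
  | [_, _, _, _, _, _, _], _ => ⟨_, _, _, _, _, _, _, rfl⟩

/-- The tables in the search space without opposite arcs are tables of rooted graphs. -/
theorem exists_graph_of_mem {c : ℕ × ℕ × ℕ} (hc : c ∈ rootedTables)
    (h2 : noTwoCycle c.2.2 = true) : ∃ (G : MixedGraph (Fin 11)) (a b p : Fin 11 → Fin 11),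
      Coded c.1 c.2.1 c.2.2 G a b p ∧ Rooted G := by
  obtain ⟨⟨A, B⟩, ht, us, hus, hbad, rfl⟩ := mem_rootedTables.1 hc
  obtain ⟨hAB, ⟨a0, b0, b1, b2, a3, b3⟩, -, -⟩ := edgeSpec_of_mem _ ht
  dsimp only at hAB a0 b0 b1 b2 a3 b3 h2 hbad ⊢
  have hperm := perm_verts hus
  obtain ⟨x10, x9, x8, x7, x6, x5, x4, rfl⟩ :
      ∃ x10 x9 x8 x7 x6 x5 x4, us = [x10, x9, x8, x7, x6, x5, x4] :=
    exists_eq_of_length_eq_seven hus.length_eq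
  set L := 3 :: 5 :: 7 :: 10 :: [x10, x9, x8, x7, x6, x5, x4].reverse
  have hlen : L.length = 11 := hperm.length_eq
  have hlt : ∀ x ∈ L, x < 11 := fun x hx => mem_verts.1 (hperm.mem_iff.1 hx)
  have hlook : ∀ i : Fin 11,
      look (pack 4 (fun x => x) L) i = L[(i : ℕ)]'(i.2.trans_eq hlen.symm) := fun i =>
    look_pack_list (fun x hx => (hlt x hx).trans (by norm_num)) i (i.2.trans_eq hlen.symm)
  have hP : ∀ i : Fin 11, look (pack 4 (fun x => x) L) i < 11 := fun i => by
    rw [hlook]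
    exact hlt _ (List.getElem_mem _)
  have hinj : ∀ i j : Fin 11, look (pack 4 (fun x => x) L) i = look (pack 4 (fun x => x) L) j →
      i = j := fun i j hij => by
    rw [hlook, hlook] at hij
    exact Fin.ext ((hperm.nodup_iff.2 (by decide)).getElem_inj_iff.1 hij)
  have p0 : look (pack 4 (fun x => x) L) 0 = 3 := hlook 0
  have p1 : look (pack 4 (fun x => x) L) 1 = 5 := hlook 1
  have p2 : look (pack 4 (fun x => x) L) 2 = 7 := hlook 2
  have p3 : look (pack 4 (fun x => x) L) 3 = 10 := hlook 3
  have hbad' : ∀ i : Fin 11, badArc A B i (look (pack 4 (fun x => x) L) i) = false := by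
    intro i
    by_cases hi : i < 4
    · rw [badArc_eq_false]
      match i, hi with
      | 0, _ =>
        change look _ 0 ≠ 0 ∧ look _ 0 ≠ look A 0 ∧ look _ 0 ≠ look B 0
        omega
      | 1, _ =>
        have : look A 1 < look B 1 := (hAB 1).1
        change look _ 1 ≠ 1 ∧ look _ 1 ≠ look A 1 ∧ look _ 1 ≠ look B 1
        omega
      | 2, _ =>
        have : look A 2 < look B 2 := (hAB 2).1
        change look _ 2 ≠ 2 ∧ look _ 2 ≠ look A 2 ∧ look _ 2 ≠ look B 2
        omega
      | 3, _ =>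
        change look _ 3 ≠ 3 ∧ look _ 3 ≠ look A 3 ∧ look _ 3 ≠ look B 3
        omega
    · rw [hlook]
      simp only [tails, List.zip_cons_cons, List.zip_nil_right, List.forall_mem_cons] at hbad
      obtain ⟨c10, c9, c8, c7, c6, c5, c4, -⟩ := hbad
      fin_cases i
      · exact absurd (by decide) hi
      · exact absurd (by decide) hi
      · exact absurd (by decide) hi
      · exact absurd (by decide) hi
      exacts [c4, c5, c6, c7, c8, c9, c10]
  rw [noTwoCycle_iff] at h2
  generalize pack 4 (fun x => x) L = P at *
  -- The test covers only the arcs that start in an outer vertex.  The arcs from the other vertices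
  -- lead to outer vertices, except `0 → 3`, which is continued by `3 → 10`.
  have hne : ∀ i : Fin 11, look P (look P i) ≠ i := by
    intro i hi
    by_cases h4 : 4 ≤ i
    · exact h2 i h4 hi
    by_cases h4' : 4 ≤ look P i
    · exact h2 ⟨look P i, hP i⟩ h4' (by rw [hi])
    match i, not_le.1 h4 with
    | 0, _ =>
      change look P (look P 0) = 0 at hi
      rw [p0, p3] at hi
      omega
    | 1, _ => exact h4' (by change 4 ≤ look P 1; omega)
    | 2, _ => exact h4' (by change 4 ≤ look P 2; omega)
    | 3, _ => exact h4' (by change 4 ≤ look P 3; omega)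
  simp only [badArc_eq_false] at hbad'
  let a : Fin 11 → Fin 11 := fun i => ⟨look A i, (hAB i).1.trans (hAB i).2.1⟩
  let b : Fin 11 → Fin 11 := fun i => ⟨look B i, (hAB i).2.1⟩
  let p : Fin 11 → Fin 11 := fun i => ⟨look P i, hP i⟩
  let G : MixedGraph (Fin 11) :=
    { edges :=
        { Adj := fun i j => j = a i ∨ j = b i
          symm := ⟨by
            rintro i j (rfl | rfl)
            · exact (hAB i).2.2.2.2.1.imp (fun h => Fin.ext h.symm) (fun h => Fin.ext h.symm)
            · exact (hAB i).2.2.2.2.2.imp (fun h => Fin.ext h.symm) (fun h => Fin.ext h.symm)⟩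
          loopless := ⟨fun i hi => hi.elim (fun h => (hAB i).2.2.1 (Fin.ext_iff.1 h).symm)
            (fun h => (hAB i).2.2.2.1 (Fin.ext_iff.1 h).symm)⟩ }
      arcs := { Adj := fun i j => j = p i }
      arcs_asymm := by
        rintro i j rfl h
        exact hne i (Fin.ext_iff.1 h).symm
      edges_disjoint_arcs := by
        rintro i j (h | h) rfl
        · exact (hbad' i).2.1 (Fin.ext_iff.1 h)
        · exact (hbad' i).2.2 (Fin.ext_iff.1 h) }
  refine ⟨G, a, b, p, ⟨⟨fun _ _ => Iff.rfl, fun i h => (hAB i).1.ne (Fin.ext_iff.1 h),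
    fun _ _ => Iff.rfl,
    Finite.injective_iff_bijective.1 fun i j hij => hinj i j (Fin.ext_iff.1 hij)⟩,
    fun _ => rfl, fun _ => rfl, fun _ => rfl⟩, ?_⟩
  exact
    { e01 := Or.inl (Fin.ext a0.symm)
      e02 := Or.inr (Fin.ext b0.symm)
      e14 := Or.inr (Fin.ext b1.symm)
      e26 := Or.inr (Fin.ext b2.symm)
      e38 := Or.inl (Fin.ext a3.symm)
      e39 := Or.inr (Fin.ext b3.symm)
      a03 := Fin.ext p0.symm
      a15 := Fin.ext p1.symm
      a27 := Fin.ext p2.symm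
      a3t := Fin.ext p3.symm }

theorem Nbrs.exists_sorted (h : G.Nbrs a b p) :
    ∃ a' b', G.Nbrs a' b' p ∧ ∀ i, a' i < b' i := by
  refine ⟨fun i => min (a i) (b i), fun i => max (a i) (b i), ⟨fun i j => ?_, fun i => ?_, h.arc,
    h.bij⟩, fun i => ?_⟩
  · rw [h.edge]
    rcases le_total (a i) (b i) with hi | hi
    · rw [min_eq_left hi, max_eq_right hi]
    · rw [min_eq_right hi, max_eq_left hi, or_comm]
  · exact (min_lt_max.2 (h.ne i)).ne
  · exact min_lt_max.2 (h.ne i)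

theorem tab_pack (f : Fin 11 → Fin 11) : Tab (pack 4 (fun x => x)
    [f 0, f 1, f 2, f 3, f 4, f 5, f 6, f 7, f 8, f 9, f 10]) f := by
  intro i
  rw [look_pack_list _ i (by simp)]
  · fin_cases i <;> rfl
  · simp only [List.mem_cons, List.not_mem_nil, or_false]
    intro x hx
    rcases hx with rfl | rfl | rfl | rfl | rfl | rfl | rfl | rfl | rfl | rfl | rfl <;> omega

/-- The search space contains tables of every rooted graph. -/
theorem Rooted.exists_mem (hr : Rooted G) (h : G.Nbrs a b p) (hab : ∀ i, a i < b i) :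
    ∃ c ∈ rootedTables, Coded c.1 c.2.1 c.2.2 G a b p := by
  have pair : ∀ i x y : Fin 11, x < y → G.edges.Adj i x → G.edges.Adj i y → a i = x ∧ b i = y := by
    intro i x y hxy hx hy
    rw [h.edge] at hx hy
    have := hab i
    rcases hx with rfl | rfl <;> rcases hy with rfl | rfl
    · exact absurd hxy (lt_irrefl _)
    · exact ⟨rfl, rfl⟩
    · exact absurd hxy this.not_gt
    · exact absurd hxy (lt_irrefl _)
  obtain ⟨a0, b0⟩ := pair 0 1 2 (by decide) hr.e01 hr.e02
  obtain ⟨a1, b1⟩ := pair 1 0 4 (by decide) hr.e01.symm hr.e14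
  obtain ⟨a2, b2⟩ := pair 2 0 6 (by decide) hr.e02.symm hr.e26
  obtain ⟨a3, b3⟩ := pair 3 8 9 (by decide) hr.e38 hr.e39
  have p0 : p 0 = 3 := ((h.arc _ _).1 hr.a03).symm
  have p1 : p 1 = 5 := ((h.arc _ _).1 hr.a15).symm
  have p2 : p 2 = 7 := ((h.arc _ _).1 hr.a27).symm
  have p3 : p 3 = 10 := ((h.arc _ _).1 hr.a3t).symm
  let rowOf : Fin 11 → ℕ × ℕ × ℕ := fun i => (i, a i, b i)
  let q : ℕ × ℕ × ℕ → Prop := fun r => ∃ i, r = rowOf i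
  have hq : ∀ r s, q r → q s → compat r s = true := by
    rintro _ _ ⟨i, rfl⟩ ⟨j, rfl⟩
    rw [compat, beq_iff_eq, Bool.eq_iff_iff, Bool.or_eq_true, Bool.or_eq_true]
    simp only [rowOf, Nat.beq_eq, Fin.val_inj]
    rw [← h.edge, ← h.edge]
    exact ⟨fun h => h.symm, fun h => h.symm⟩
  have hinner : ∀ r ∈ innerRows, q r := by
    simp only [innerRows, List.forall_mem_cons]
    exact ⟨⟨0, by simp [rowOf, a0, b0]⟩, ⟨1, by simp [rowOf, a1, b1]⟩, ⟨2, by simp [rowOf, a2, b2]⟩,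
      ⟨3, by simp [rowOf, a3, b3]⟩, by simp⟩
  have hself : ∀ i, a i ≠ i ∧ b i ≠ i := fun i =>
    ⟨fun he => G.edges.irrefl (v := i) ((h.edge i i).2 (Or.inl he.symm)),
      fun he => G.edges.irrefl (v := i) ((h.edge i i).2 (Or.inr he.symm))⟩
  have hopt : ∀ i : Fin 11, rowOf i ∈ rowOptions i ∧ q (rowOf i) := by
    intro i
    refine ⟨?_, i, rfl⟩
    rw [rowOptions, List.mem_filter]
    constructor
    · rw [List.mem_flatMap]
      exact ⟨a i, mem_verts.2 (a i).2, List.mem_map.2 ⟨b i, mem_verts.2 (b i).2, rfl⟩⟩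
    · have h1 : Nat.blt (a i) (b i) = true := Nat.ble_eq_true_of_le (hab i)
      have h2 : Nat.beq (a i) i = false := by
        rw [← Bool.not_eq_true, Nat.beq_eq, Fin.val_inj]
        exact (hself i).1
      have h3 : Nat.beq (b i) i = false := by
        rw [← Bool.not_eq_true, Nat.beq_eq, Fin.val_inj]
        exact (hself i).2
      have h4 : innerRows.all (compat (rowOf i)) = true :=
        List.all_eq_true.2 fun s hs => hq _ _ ⟨i, rfl⟩ (hinner s hs)
      simp only [rowOf] at h4 ⊢
      rw [h1, h2, h3, h4]
      rfl
  have hrows := mem_chooseRows hq (opts := [9, 8, 7, 6, 5, 4].map rowOptions)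
    (rs := [rowOf 9, rowOf 8, rowOf 7, rowOf 6, rowOf 5, rowOf 4]) (acc := [rowOf 10])
    (.cons (hopt 9) (.cons (hopt 8) (.cons (hopt 7) (.cons (hopt 6) (.cons (hopt 5)
      (.cons (hopt 4) .nil)))))) (by simpa using ⟨10, rfl⟩)
  -- The tables are hidden in variables so that unification does not evaluate them.
  obtain ⟨A, hA⟩ : ∃ A, A = pack 4 (fun x => x) [(a 0 : ℕ), a 1, a 2, a 3, a 4, a 5, a 6, a 7, a 8,
    a 9, a 10] := ⟨_, rfl⟩
  obtain ⟨B, hB⟩ : ∃ B, B = pack 4 (fun x => x) [(b 0 : ℕ), b 1, b 2, b 3, b 4, b 5, b 6, b 7, b 8,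
    b 9, b 10] := ⟨_, rfl⟩
  have ht : (A, B) ∈ (rowOptions 10).flatMap edgeTables := by
    rw [List.mem_flatMap]
    refine ⟨rowOf 10, (hopt 10).1, List.mem_map.2 ⟨_, hrows, ?_⟩⟩
    rw [hA, hB, a0, a1, a2, a3, b0, b1, b2, b3]
    rfl
  have tabA : Tab A a := hA ▸ tab_pack a
  have tabB : Tab B b := hB ▸ tab_pack b
  let us : List ℕ := [10, 9, 8, 7, 6, 5, 4].map fun i : Fin 11 => (p i : ℕ)
  have hinj : Function.Injective fun i : Fin 11 => (p i : ℕ) := Fin.val_injective.comp h.bij.1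
  have hus : us.Perm heads := by
    refine (List.subperm_of_subset (List.Nodup.map hinj (by decide)) ?_).perm_of_length_le le_rfl
    intro x hx
    obtain ⟨i, hi, rfl⟩ := List.mem_map.1 hx
    have hi4 : 4 ≤ i := (by decide : ∀ i : Fin 11, i ∈ [10, 9, 8, 7, 6, 5, 4] → 4 ≤ i) i hi
    have hne : ∀ j : Fin 11, j < 4 → p i ≠ p j := fun j hj he =>
      absurd (h.bij.1 he ▸ hi4) (not_le.2 hj)
    have h0 := hne 0 (by decide)
    have h1 := hne 1 (by decide)
    have h2 := hne 2 (by decide)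
    have h3 := hne 3 (by decide)
    rw [p0] at h0
    rw [p1] at h1
    rw [p2] at h2
    rw [p3] at h3
    exact (by decide : ∀ x : Fin 11, x ≠ 3 → x ≠ 5 → x ≠ 7 → x ≠ 10 → (x : ℕ) ∈ heads) (p i)
      h0 h1 h2 h3
  have hb : ∀ i : Fin 11, badArc A B i (p i) = false := by
    intro i
    rw [badArc_eq_false, tabA, tabB]
    have hp := (h.arc i _).2 rfl
    refine ⟨fun he => G.arcs_asymm i i ?_ ?_,
      fun he => G.edges_disjoint_arcs i (p i) ((h.edge _ _).2 (Or.inl (Fin.ext he))) hp,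
      fun he => G.edges_disjoint_arcs i (p i) ((h.edge _ _).2 (Or.inr (Fin.ext he))) hp⟩ <;>
    rwa [Fin.ext he] at hp
  have hzip : ∀ x ∈ tails.zip us, badArc A B x.1 x.2 = false := by
    simp only [us, tails, List.map_cons, List.map_nil, List.zip_cons_cons, List.zip_nil_right,
      List.forall_mem_cons]
    exact ⟨hb 10, hb 9, hb 8, hb 7, hb 6, hb 5, hb 4, by simp⟩
  have tabP : Tab (pack 4 (fun x => x) (3 :: 5 :: 7 :: 10 :: us.reverse)) p := by
    have hl : 3 :: 5 :: 7 :: 10 :: us.reverse =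
        [(p 0 : ℕ), p 1, p 2, p 3, p 4, p 5, p 6, p 7, p 8, p 9, p 10] := by
      rw [p0, p1, p2, p3]
      rfl
    rw [hl]
    exact tab_pack p
  obtain ⟨P, hP⟩ : ∃ P, P = pack 4 (fun x => x) (3 :: 5 :: 7 :: 10 :: us.reverse) := ⟨_, rfl⟩
  rw [← hP] at tabP
  exact ⟨(A, B, P), mem_rootedTables.2 ⟨(A, B), ht, us, hus, hzip, by rw [hP]⟩, h, tabA, tabB,
    tabP⟩

theorem Nbrs.unique {a' b' p' : Fin 11 → Fin 11} (h : G.Nbrs a b p) (h' : G.Nbrs a' b' p')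
    (hab : ∀ i, a i < b i) (hab' : ∀ i, a' i < b' i) : a = a' ∧ b = b' ∧ p = p' := by
  have key : ∀ i, a i = a' i ∧ b i = b' i := by
    intro i
    have h1 := (h'.edge i (a i)).1 ((h.edge i (a i)).2 (Or.inl rfl))
    have h2 := (h'.edge i (b i)).1 ((h.edge i (b i)).2 (Or.inr rfl))
    have h3 := hab i
    have h4 := hab' i
    rcases h1 with h1 | h1 <;> rcases h2 with h2 | h2 <;> rw [h1, h2] at h3
    · exact absurd h3 (lt_irrefl _)
    · exact ⟨h1, h2⟩
    · exact absurd h3 h4.not_gt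
    · exact absurd h3 (lt_irrefl _)
  exact ⟨funext fun i => (key i).1, funext fun i => (key i).2,
    funext fun i => (h'.arc _ _).1 ((h.arc _ _).2 rfl)⟩

theorem look_lt_of_mem {c : ℕ × ℕ × ℕ} (hc : c ∈ rootedTables) (i : Fin 11) :
    look c.1 i < look c.2.1 i := by
  obtain ⟨t, ht, us, -, -, rfl⟩ := mem_rootedTables.1 hc
  exact ((edgeSpec_of_mem t ht).1 i).1

/-- A rooted graph has only one triple of tables in the search space. -/
theorem eq_of_coded {c c' : ℕ × ℕ × ℕ} {a' b' p' : Fin 11 → Fin 11} (hc : c ∈ rootedTables)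
    (hc' : c' ∈ rootedTables) (h : Coded c.1 c.2.1 c.2.2 G a b p)
    (h' : Coded c'.1 c'.2.1 c'.2.2 G a' b' p') : c = c' := by
  have norm : ∀ {c : ℕ × ℕ × ℕ}, c ∈ rootedTables →
      pack 4 (look c.1) verts = c.1 ∧ pack 4 (look c.2.1) verts = c.2.1 ∧
      pack 4 (look c.2.2) verts = c.2.2 := by
    intro c hc
    obtain ⟨t, ht, us, hus, -, rfl⟩ := mem_rootedTables.1 hc
    obtain ⟨-, -, h2, h3⟩ := edgeSpec_of_mem _ ht
    have hperm := perm_verts hus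
    dsimp only
    exact ⟨h2, h3, pack_look_list hperm.length_eq fun x hx =>
      (mem_verts.1 (hperm.mem_iff.1 hx)).trans (by norm_num)⟩
  obtain ⟨n2, n3, n4⟩ := norm hc
  obtain ⟨m2, m3, m4⟩ := norm hc'
  obtain ⟨rfl, rfl, rfl⟩ := h.toNbrs.unique h'.toNbrs
    (fun i => Fin.lt_def.2 (by rw [← h.tabA, ← h.tabB]; exact look_lt_of_mem hc i))
    (fun i => Fin.lt_def.2 (by rw [← h'.tabA, ← h'.tabB]; exact look_lt_of_mem hc' i))
  have tabs : ∀ {T T' : ℕ} {f : Fin 11 → Fin 11}, Tab T f → Tab T' f →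
      pack 4 (look T) verts = pack 4 (look T') verts := fun hT hT' =>
    pack_congr (forall_mem_verts.2 fun i => (hT i).trans (hT' i).symm)
  refine Prod.ext ?_ (Prod.ext ?_ ?_)
  · rw [← n2, ← m2, tabs h.tabA h'.tabA]
  · rw [← n3, ← m3, tabs h.tabB h'.tabB]
  · rw [← n4, ← m4, tabs h.tabP h'.tabP]

end

/-! ### Representatives of the isomorphism classes -/

section

variable {A B P : ℕ} {G : MixedGraph (Fin 11)} {a b p : Fin 11 → Fin 11}

/-- The tables determine the graph. -/
theorem Coded.eq {G' : MixedGraph (Fin 11)} {a' b' p' : Fin 11 → Fin 11}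
    (h : Coded A B P G a b p) (h' : Coded A B P G' a' b' p') : G = G' := by
  have tabs : ∀ {T : ℕ} {f g : Fin 11 → Fin 11}, Tab T f → Tab T g → f = g := fun hf hg =>
    funext fun i => Fin.ext ((hf i).symm.trans (hg i))
  obtain rfl := tabs h.tabA h'.tabA
  obtain rfl := tabs h.tabB h'.tabB
  obtain rfl := tabs h.tabP h'.tabP
  ext i j
  · rw [h.edge, h'.edge]
  · rw [h.arc, h'.arc]

theorem Coded.diamLe_iff (h : Coded A B P G a b p) :
    diamLe A B P (balls A B P) = true ↔ ∀ i j, G.dist i j ≤ (3 : ℕ) := by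
  rw [diamLe, allOf_eq_true, forall_mem_verts]
  simp only [Nat.beq_eq, h.nextBall_balls_eq]

/-- The key of a graph with its own labelling. -/
def ownKey (c : ℕ × ℕ × ℕ) : ℕ ×ₗ ℕ := toLex (ownKeyE c, ownKeyP c)

theorem Coded.isLeast_iff (h : Coded A B P G a b p) (KE KP : ℕ) :
    isLeast A B P (balls A B P) KE KP = true ↔
      ∀ v : Fin 11, (∀ j, G.dist v j ≤ (2 : ℕ)) → allLabs A B P v (keyLe A B P KE KP) = true := by
  rw [isLeast, allOf_eq_true, forall_mem_verts]
  refine forall_congr' fun v => ?_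
  have hiff : Nat.beq (row (balls A B P) v) 2047 = true ↔ ∀ j, G.dist v j ≤ (2 : ℕ) := by
    rw [Nat.beq_eq, h.row_balls_eq]
  rw [sel_eq, ← hiff]
  split_ifs with hv
  · exact ⟨fun hl _ => hl, fun hl => hl hv⟩
  · exact ⟨fun _ hv' => absurd hv' hv, fun _ => rfl⟩

theorem Rooted.dist_comap_le_two {σ : Equiv.Perm (Fin 11)} (hr : Rooted (G.comap σ)) (j : Fin 11) :
    G.dist (σ 0) j ≤ (2 : ℕ) := by
  have := hr.dist_le_two (σ.symm j)
  rwa [dist_comap, σ.apply_symm_apply] at this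

theorem Coded.keyLe_iff_ownKey_le {c c' : ℕ × ℕ × ℕ} {a' b' p' : Fin 11 → Fin 11}
    {σ : Equiv.Perm (Fin 11)} (h : Coded c.1 c.2.1 c.2.2 G a b p)
    (h' : Coded c'.1 c'.2.1 c'.2.2 (G.comap σ) a' b' p') (hr : Rooted (G.comap σ)) :
    keyLe c.1 c.2.1 c.2.2 (ownKeyE c) (ownKeyP c)
      (labTab c.1 c.2.1 c.2.2 (σ 0) (σ 1) (σ 2) (σ 8) (σ 9)) = true ↔ ownKey c ≤ ownKey c' := by
  have hS := h.tab_labTab hr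
  obtain ⟨h1, h2⟩ := h.keys_comap h' hS (tab_invTab hS)
  rw [keyLe_iff, h1, h2]
  rfl

/-- The test `isLeast` says that the key of the graph is the least among the keys of the rooted
graphs isomorphic to it. -/
theorem Coded.isLeast_iff_ownKey_le {c : ℕ × ℕ × ℕ} (h : Coded c.1 c.2.1 c.2.2 G a b p) :
    isLeast c.1 c.2.1 c.2.2 (ownBalls c) (ownKeyE c) (ownKeyP c) = true ↔
      ∀ (σ : Equiv.Perm (Fin 11)), Rooted (G.comap σ) → ∀ c' ∈ rootedTables, ∀ a' b' p',
        Coded c'.1 c'.2.1 c'.2.2 (G.comap σ) a' b' p' → ownKey c ≤ ownKey c' := by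
  rw [ownBalls, h.isLeast_iff]
  constructor
  · intro hl σ hr c' _ a' b' p' h'
    have := hl (σ 0) hr.dist_comap_le_two
    rw [h.allLabs_iff hr.dist_comap_le_two] at this
    exact (h.keyLe_iff_ownKey_le h' hr).1 (this σ rfl hr)
  · intro hl v hv
    rw [h.allLabs_iff hv]
    rintro σ rfl hr
    have hn : (G.comap σ).IsTotallyRegular 2 1 := by
      refine Nbrs.isTotallyRegular (a := σ.symm ∘ a ∘ σ) (b := σ.symm ∘ b ∘ σ)
        (p := σ.symm ∘ p ∘ σ) ⟨fun i j => ?_, fun i he => ?_, fun i j => ?_, ?_⟩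
      · refine (h.edge (σ i) (σ j)).trans ?_
        simp only [Function.comp_apply, Equiv.eq_symm_apply]
      · exact h.ne (σ i) (σ.symm.injective he)
      · refine (h.arc (σ i) (σ j)).trans ?_
        simp only [Function.comp_apply, Equiv.eq_symm_apply]
      · exact σ.symm.bijective.comp (h.bij.comp σ.bijective)
    obtain ⟨a₁, b₁, p₁, hn⟩ := hn.exists_nbrs
    obtain ⟨a₂, b₂, hn, hab⟩ := hn.exists_sorted
    obtain ⟨c', hc', h'⟩ := hr.exists_mem hn hab
    exact (h.keyLe_iff_ownKey_le h' hr).2 (hl σ hr c' hc' _ _ _ h')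

theorem allLabs_eq (A B P v : ℕ) (f : ℕ → Bool) : allLabs A B P v f =
    band (f (labTab A B P v (look A v) (look B v) (look A (look P v)) (look B (look P v))))
      (band (f (labTab A B P v (look B v) (look A v) (look A (look P v)) (look B (look P v))))
      (band (f (labTab A B P v (look A v) (look B v) (look B (look P v)) (look A (look P v))))
        (f (labTab A B P v (look B v) (look A v) (look B (look P v)) (look A (look P v)))))) :=
  rfl

/-- The labellings with root `0` of a rooted graph depend only on the arcs of the Moore tree. -/
theorem allLabs_root {A B P Q : ℕ} (hA : look A 0 = 1) (hB : look B 0 = 2)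
    (h0 : look Q 0 = look P 0) (h1 : look Q 1 = look P 1) (h2 : look Q 2 = look P 2)
    (h3 : look Q (look P 0) = look P (look P 0)) (f : ℕ → Bool) :
    allLabs A B Q 0 f = allLabs A B P 0 f := by
  have hl : ∀ z w, labTab A B Q 0 1 2 z w = labTab A B P 0 1 2 z w ∧
      labTab A B Q 0 2 1 z w = labTab A B P 0 2 1 z w := by
    intro z w
    rw [labTab, labTab, labTab, labTab, h0, h1, h2, h3]
    exact ⟨rfl, rfl⟩
  rw [allLabs_eq, allLabs_eq, hA, hB, h0, (hl _ _).1, (hl _ _).1, (hl _ _).2, (hl _ _).2]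

theorem allLabs_mono {A B P v : ℕ} {f g : ℕ → Bool} (hfg : ∀ S, f S = true → g S = true)
    (h : allLabs A B P v f = true) : allLabs A B P v g = true := by
  rw [allLabs_eq, band_eq_true, band_eq_true, band_eq_true] at h ⊢
  exact ⟨hfg _ h.1, hfg _ h.2.1, hfg _ h.2.2.1, hfg _ h.2.2.2⟩

theorem look_arcTable_zero : look (arcTable 0) 0 = 3 ∧ look (arcTable 0) 1 = 5 ∧
    look (arcTable 0) 2 = 7 ∧ look (arcTable 0) 3 = 10 := by
  decide +kernel

theorem edgesLeast_of_allLabs {A B P KE KP : ℕ} (hA : look A 0 = 1) (hB : look B 0 = 2)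
    (h0 : look P 0 = 3) (h1 : look P 1 = 5) (h2 : look P 2 = 7) (h3 : look P 3 = 10)
    (hl : allLabs A B P 0 (keyLe A B P KE KP) = true) : edgesLeast A B KE = true := by
  obtain ⟨z0, z1, z2, z3⟩ := look_arcTable_zero
  rw [edgesLeast, allLabs_root hA hB (z0.trans h0.symm) (z1.trans h1.symm) (z2.trans h2.symm)
    (by rw [h0, z3, h3])]
  refine allLabs_mono (fun S hS => ?_) hl
  rw [keyLe_iff, Prod.Lex.toLex_le_toLex] at hS
  rw [force_eq]
  generalize keyE A B S (invTab S) = k at hS ⊢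
  exact Nat.ble_eq_true_of_le (hS.elim le_of_lt fun h => h.1.le)

/-- The test of the edges alone is necessary: the labellings with root `0` use no arcs but those of
the Moore tree. -/
theorem edgesLeast_of_isLeast {c : ℕ × ℕ × ℕ} (h : Coded c.1 c.2.1 c.2.2 G a b p) (hr : Rooted G)
    (hab : ∀ i, a i < b i)
    (hl : isLeast c.1 c.2.1 c.2.2 (ownBalls c) (ownKeyE c) (ownKeyP c) = true) :
    edgesLeast c.1 c.2.1 (ownKeyE c) = true := by
  rw [ownBalls, h.isLeast_iff] at hl
  have hl := hl 0 hr.dist_le_two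
  obtain ⟨p0, p1, p2, p3⟩ := hr.p_eq h
  have hA : a 0 = 1 ∧ b 0 = 2 := by
    have h1 := (h.edge 0 1).1 hr.e01
    have h2 := (h.edge 0 2).1 hr.e02
    have h3 := hab 0
    omega
  exact edgesLeast_of_allLabs ((h.tabA 0).trans (congrArg Fin.val hA.1))
    ((h.tabB 0).trans (congrArg Fin.val hA.2)) ((h.tabP 0).trans (congrArg Fin.val p0))
    ((h.tabP 1).trans (congrArg Fin.val p1)) ((h.tabP 2).trans (congrArg Fin.val p2))
    ((h.tabP 3).trans (congrArg Fin.val p3)) hl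

theorem accepted_iff {c : ℕ × ℕ × ℕ} : accepted c = true ↔
    edgesLeast c.1 c.2.1 (ownKeyE c) = true ∧ noTwoCycle c.2.2 = true ∧
      diamLe c.1 c.2.1 c.2.2 (ownBalls c) = true ∧
        isLeast c.1 c.2.1 c.2.2 (ownBalls c) (ownKeyE c) (ownKeyP c) = true := by
  rw [accepted, Bool.and_eq_true, Bool.and_eq_true, Bool.and_eq_true, and_assoc, and_assoc]

/-- Every radial Moore graph is isomorphic to an accepted one: take a rooted graph of least key in
its isomorphism class. -/
theorem exists_accepted {V : Type*} [Fintype V] {G : MixedGraph V} (hG : G.IsRadialMoore 2 1 2) :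
    ∃ c ∈ rootedTables, accepted c = true ∧ ∃ (H : MixedGraph (Fin 11)) (a b p : _),
      Coded c.1 c.2.1 c.2.2 H a b p ∧ Rooted H ∧ H.Isomorphic G := by
  let S : Set (ℕ ×ₗ ℕ) := {k | ∃ c ∈ rootedTables, (∃ (H : MixedGraph (Fin 11)) (a b p : _),
    Coded c.1 c.2.1 c.2.2 H a b p ∧ Rooted H ∧ (∀ i, a i < b i) ∧ H.Isomorphic G) ∧ ownKey c = k}
  have hS : S.Nonempty := by
    obtain ⟨a, b, p, hn⟩ := hG.1.exists_nbrs
    obtain ⟨⟨v, hv⟩, -, -⟩ := (hn.isRadialMoore_iff hG.card_eq).1 hG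
    obtain ⟨σ, hr, -⟩ := hn.exists_rooted hG.card_eq hv (hn.edge v) (hn.edge (p v))
    obtain ⟨a₁, b₁, p₁, hn⟩ := (hG.comap σ).1.exists_nbrs
    obtain ⟨a₂, b₂, hn, hab⟩ := hn.exists_sorted
    obtain ⟨c, hc, h⟩ := hr.exists_mem hn hab
    exact ⟨_, c, hc, ⟨_, _, _, _, h, hr, hab, comap_isomorphic G σ⟩, rfl⟩
  obtain ⟨_, ⟨c, hc, ⟨H, a, b, p, h, hr, hab, hi⟩, rfl⟩, hmin⟩ := wellFounded_lt.has_min S hS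
  refine ⟨c, hc, ?_, H, a, b, p, h, hr, hi⟩
  have hH := (h.toNbrs.isRadialMoore_iff (by simp)).1 (hG.of_isomorphic hi)
  have hl : isLeast c.1 c.2.1 c.2.2 (ownBalls c) (ownKeyE c) (ownKeyP c) = true := by
    rw [h.isLeast_iff_ownKey_le]
    intro σ hσ c' hc' a' b' p' h'
    refine not_lt.1 (hmin _ ⟨c', hc', ⟨_, a', b', p', h', hσ, ?_,
      (comap_isomorphic H σ).trans hi⟩, rfl⟩)
    intro i
    rw [Fin.lt_def, ← h'.tabA, ← h'.tabB]
    exact look_lt_of_mem hc' i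
  refine accepted_iff.2 ⟨edgesLeast_of_isLeast h hr hab hl, ?_, (h.diamLe_iff).2 hH.2.1, hl⟩
  rw [noTwoCycle_iff]
  intro i _ hi
  rw [h.tabP, h.tabP, Fin.val_inj] at hi
  exact H.arcs_asymm i (p i) ((h.arc _ _).2 rfl) ((h.arc _ _).2 hi.symm)

/-- Isomorphic accepted graphs are equal. -/
theorem eq_of_isomorphic {c c' : ℕ × ℕ × ℕ} {H H' : MixedGraph (Fin 11)}
    {a' b' p' : Fin 11 → Fin 11} (hc : c ∈ rootedTables) (hc' : c' ∈ rootedTables)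
    (ha : accepted c = true) (ha' : accepted c' = true) (h : Coded c.1 c.2.1 c.2.2 H a b p)
    (h' : Coded c'.1 c'.2.1 c'.2.2 H' a' b' p') (hr : Rooted H) (hr' : Rooted H')
    (hi : H.Isomorphic H') : c = c' := by
  have key : ∀ {c c' : ℕ × ℕ × ℕ} {H H' : MixedGraph (Fin 11)} {a b p a' b' p' : Fin 11 → Fin 11},
      c' ∈ rootedTables → accepted c = true → Coded c.1 c.2.1 c.2.2 H a b p →
      Coded c'.1 c'.2.1 c'.2.2 H' a' b' p' → Rooted H' → H'.Isomorphic H →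
      ownKey c ≤ ownKey c' := by
    rintro c c' H H' a b p a' b' p' hc' ha h h' hr' ⟨σ, h1, h2⟩
    obtain rfl := eq_comap h1 h2
    exact h.isLeast_iff_ownKey_le.1 (accepted_iff.1 ha).2.2.2 σ hr' c' hc' _ _ _ h'
  have he : ownKey c = ownKey c' :=
    le_antisymm (key hc' ha h h' hr' hi.symm) (key hc ha' h' h hr hi)
  obtain ⟨hE, hP⟩ := Prod.mk.inj (toLex_inj.1 he)
  rw [ownKeyE, ownKeyE] at hE
  rw [ownKeyP, ownKeyP] at hP
  obtain rfl := hr.eq_of_keys_eq hr' h h' hE hP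
  exact eq_of_coded hc hc' h h'

theorem far_iff {T : ℕ} : far A B P T = true ↔ 8 ≤ (verts.map (deficit T)).sum ∧
    (9 ≤ (verts.map (deficit T)).sum ∨ 11 ≤ (verts.map fun i => deficit T i ^ 2).sum ∨
      (A, B, P) = code₁ ∨ (A, B, P) = code₂) := by
  have hcode : ∀ c : ℕ × ℕ × ℕ, isCode c A B P = true ↔ (A, B, P) = c := by
    rintro ⟨A', B', P'⟩
    simp only [isCode, band_eq_true, Nat.beq_eq, Prod.mk.injEq]
  have hsq : (fun i => force (deficit T i) fun e => Nat.mul e e) = fun i => deficit T i ^ 2 := by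
    funext i
    exact (sq _).symm
  rw [far, force_eq, band_eq_true, bor_eq_true, bor_eq_true, bor_eq_true, hcode, hcode, hsq,
    sumOf_eq, sumOf_eq, Nat.ble_eq, Nat.ble_eq, Nat.ble_eq]

/-- A graph that is accepted and far is radial Moore: as the deficits do not vanish, it is not a
mixed Moore graph. -/
theorem Coded.isRadialMoore (h : Coded A B P G a b p) (hr : Rooted G)
    (h3 : ∀ i j, G.dist i j ≤ (3 : ℕ)) (hf : far A B P (balls A B P) = true) :
    G.IsRadialMoore 2 1 2 := by
  refine (h.toNbrs.isRadialMoore_iff (by simp)).2 ⟨⟨0, hr.dist_le_two⟩, h3, ?_⟩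
  by_contra! hc
  have hz : ∀ i : Fin 11, deficit (balls A B P) i = 0 := by
    intro i
    have h1 := h.ncard_add_deficit i
    have h2 : {j | G.dist i j ≤ (2 : ℕ)} = Set.univ := Set.eq_univ_of_forall (hc i)
    rw [h2, Set.ncard_univ, Nat.card_eq_fintype_card, Fintype.card_fin] at h1
    exact Nat.add_left_cancel (h1.trans (Nat.add_zero 11).symm)
  have hs := (far_iff.1 hf).1
  generalize deficit (balls A B P) = d at hz hs
  have hm : verts.map d = verts.map fun _ => 0 :=
    List.map_congr_left (forall_mem_verts.2 hz)
  rw [hm] at hs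
  simp at hs

end

/-! ### Evaluation of the search -/

theorem rowOptions_ten : rowOptions 10 = [(10, 4, 5), (10, 4, 6), (10, 4, 7), (10, 4, 8),
    (10, 4, 9), (10, 5, 6), (10, 5, 7), (10, 5, 8), (10, 5, 9), (10, 6, 7), (10, 6, 8),
    (10, 6, 9), (10, 7, 8), (10, 7, 9), (10, 8, 9)] := by
  decide +kernel

theorem totalWeight_four_five : totalWeight (10, 4, 5) = 1684 := by decide +kernel

theorem totalWeight_four_six : totalWeight (10, 4, 6) = 279 := by decide +kernel

theorem totalWeight_four_eight : totalWeight (10, 4, 8) = 1005 := by decide +kernel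

theorem totalWeight_five_six : totalWeight (10, 5, 6) = 1633 := by decide +kernel

theorem totalWeight_five_seven : totalWeight (10, 5, 7) = 1859 := by decide +kernel

theorem totalWeight_five_eight : totalWeight (10, 5, 8) = 2856 := by decide +kernel

theorem totalWeight_eight_nine : totalWeight (10, 8, 9) = 170 := by decide +kernel

theorem totalWeight_eq_zero : totalWeight (10, 4, 7) = 0 ∧ totalWeight (10, 4, 9) = 0 ∧
    totalWeight (10, 5, 9) = 0 ∧ totalWeight (10, 6, 7) = 0 ∧ totalWeight (10, 6, 8) = 0 ∧
    totalWeight (10, 6, 9) = 0 ∧ totalWeight (10, 7, 8) = 0 ∧ totalWeight (10, 7, 9) = 0 := by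
  decide +kernel

theorem sum_totalWeight : ((rowOptions 10).map totalWeight).sum = 9486 := by
  obtain ⟨h1, h2, h3, h4, h5, h6, h7, h8⟩ := totalWeight_eq_zero
  rw [rowOptions_ten]
  simp only [List.map_cons, List.map_nil, List.sum_cons, List.sum_nil, h1, h2, h3, h4, h5, h6, h7,
    h8, totalWeight_four_five, totalWeight_four_six, totalWeight_four_eight, totalWeight_five_six,
    totalWeight_five_seven, totalWeight_five_eight, totalWeight_eight_nine]
  rfl

/-- The weight of a triple of tables, in terms of `accepted` and `isFar`. -/
def ownWeight (c : ℕ × ℕ × ℕ) : ℕ := sel (accepted c) (sel (isFar c) 1 10000) 0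

theorem weight_eq {A B P : ℕ} (h : edgesLeast A B (ownKeyE (A, B, P)) = true) :
    weight A B (ownKeyE (A, B, P)) P = ownWeight (A, B, P) := by
  rw [ownWeight, accepted, h, weight, force_eq, force_eq, isFar, ownBalls, ownKeyP]
  dsimp only
  -- The Boolean tests become variables, since unification must not evaluate them.
  generalize noTwoCycle P = b₁
  generalize diamLe A B P (balls A B P) = b₂
  generalize isLeast A B P (balls A B P) _ _ = b₃
  generalize far A B P (balls A B P) = b₄
  cases b₁ <;> cases b₂ <;> cases b₃ <;> rfl

theorem edgeWeight_eq (A B : ℕ) : edgeWeight A B =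
    ((arcLists (badArc A B) tails heads []).map fun l =>
      ownWeight (A, B, arcTable (pack 4 (fun x => x) l))).sum := by
  have hk : ∀ P, keyE A B idTab idTab = ownKeyE (A, B, P) := fun _ => rfl
  rw [edgeWeight, force_eq, sel_eq]
  split_ifs with he
  · rw [show (0 : ℕ) = pack 4 (fun x => x) [] from rfl, arcSum_eq]
    refine congrArg List.sum (List.map_congr_left fun l _ => ?_)
    rw [force_eq, hk (arcTable (pack 4 (fun x => x) l)), weight_eq]
    rwa [← hk]
  · rw [eq_comm, List.sum_eq_zero_iff]
    intro x hx
    obtain ⟨l, -, rfl⟩ := List.mem_map.1 hx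
    rw [hk (arcTable (pack 4 (fun x => x) l))] at he
    rw [ownWeight, sel_eq, if_neg]
    exact fun ha => he (accepted_iff.1 ha).1

theorem sum_ownWeight : (rootedTables.map ownWeight).sum = 9486 := by
  rw [rootedTables, sum_map_flatMap, sum_map_flatMap]
  refine Eq.trans ?_ sum_totalWeight
  refine congrArg List.sum (List.map_congr_left fun r _ => ?_)
  rw [totalWeight, sumOf_eq]
  refine congrArg List.sum (List.map_congr_left fun t _ => ?_)
  obtain ⟨A, B⟩ := t
  rw [force_eq, force_eq, edgeWeight_eq, List.map_map]
  -- Otherwise unification would unfold the weights.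
  generalize ownWeight = w
  rfl

/-- In this sum each element that satisfies `f` contributes `1` or `10000`, depending on `g`.  If
the sum is less than `10000`, no element contributes `10000`, and the sum counts those that satisfy
`f`. -/
theorem length_filter_of_sum_sel {α : Type*} {f g : α → Bool} {l : List α} {n : ℕ} (hn : n < 10000)
    (h : (l.map fun x => sel (f x) (sel (g x) 1 10000) 0).sum = n) :
    (l.filter f).length = n ∧ ∀ x ∈ l, f x = true → g x = true := by
  induction l generalizing n with
  | nil => exact ⟨h, by simp⟩
  | cons x l ih =>
    rw [List.map_cons, List.sum_cons, sel_eq, sel_eq] at h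
    rw [List.filter_cons, List.forall_mem_cons]
    split_ifs at h ⊢ with hf hg
    · obtain ⟨h1, h2⟩ := ih (n := n - 1) (by omega) (by omega)
      exact ⟨by rw [List.length_cons]; omega, fun _ => hg, h2⟩
    · omega
    · obtain ⟨h1, h2⟩ := ih (n := n) hn (by omega)
      exact ⟨h1, fun hx => absurd hx hf, h2⟩

theorem length_filter_accepted : (rootedTables.filter accepted).length = 9486 :=
  (length_filter_of_sum_sel (by norm_num) sum_ownWeight).1

theorem isFar_of_accepted {c : ℕ × ℕ × ℕ} (hc : c ∈ rootedTables) (ha : accepted c = true) :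
    isFar c = true :=
  (length_filter_of_sum_sel (by norm_num) sum_ownWeight).2 c hc ha

theorem nodup_rootedTables : rootedTables.Nodup := by
  rw [rootedTables, List.nodup_flatMap]
  constructor
  · intro t _
    have hn := nodup_arcLists (bad := badArc t.1 t.2) (tails := tails) (heads := heads)
      (acc := []) (by decide)
    refine List.Nodup.map_on (fun l hl l' hl' he => ?_) hn
    have he : arcTable (pack 4 (fun x => x) l) = arcTable (pack 4 (fun x => x) l') :=
      (Prod.mk.inj (Prod.mk.inj he).2).2
    have hlt : ∀ l ∈ arcLists (badArc t.1 t.2) tails heads [], l.length = 7 ∧ ∀ x ∈ l, x < 16 := by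
      intro l hl
      obtain ⟨us, h1, -, rfl⟩ := (mem_arcLists length_heads).1 hl
      rw [List.append_nil]
      refine ⟨(List.length_reverse).trans h1.length_eq, fun x hx => ?_⟩
      exact (by decide : ∀ x ∈ heads, x < 16) x (h1.mem_iff.1 (List.mem_reverse.1 hx))
    obtain ⟨h1, h2⟩ := hlt l hl
    obtain ⟨h1', h2'⟩ := hlt l' hl'
    have hp : pack 4 (fun x => x) l = pack 4 (fun x => x) l' := by
      rw [arcTable_pack, arcTable_pack] at he
      simp only [pack_cons] at he
      omega
    refine List.ext_getElem (h1.trans h1'.symm) fun n hn hn' => ?_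
    rw [← look_pack_list h2 n hn, ← look_pack_list h2' n hn', hp]
  · refine nodup_edgeTables.imp fun {t t'} hne c hc hc' => hne ?_
    obtain ⟨l, -, rfl⟩ := List.mem_map.1 hc
    obtain ⟨l', -, he⟩ := List.mem_map.1 hc'
    exact (Prod.ext (Prod.mk.inj he).1 (Prod.mk.inj (Prod.mk.inj he).2).1).symm

theorem exists_of_accepted {c : ℕ × ℕ × ℕ} (hc : c ∈ rootedTables) (ha : accepted c = true) :
    ∃ (G : MixedGraph (Fin 11)) (a b p : Fin 11 → Fin 11),
      Coded c.1 c.2.1 c.2.2 G a b p ∧ Rooted G ∧ G.IsRadialMoore 2 1 2 := by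
  obtain ⟨-, h2, h3, -⟩ := accepted_iff.1 ha
  obtain ⟨G, a, b, p, h, hr⟩ := exists_graph_of_mem hc h2
  exact ⟨G, a, b, p, h, hr, h.isRadialMoore hr (h.diamLe_iff.1 h3) (isFar_of_accepted hc ha)⟩

theorem mooreBound_eq : mooreBound 2 1 2 = 11 := by
  simp [mooreBound, mooreLevel, Finset.sum_range_succ]

/-- The accepted graphs form a system of representatives of the isomorphism classes. -/
theorem card_RM : Nat.card (RM 2 1 2) = 9486 := by
  let e : Fin (mooreBound 2 1 2) ≃ Fin 11 := finCongr mooreBound_eq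
  let C := {c : ℕ × ℕ × ℕ // c ∈ rootedTables.filter accepted}
  have hC : ∀ c : C, c.1 ∈ rootedTables ∧ accepted c.1 = true := fun c => List.mem_filter.1 c.2
  have hg := fun c : C => exists_of_accepted (hC c).1 (hC c).2
  choose H a b p hH hr hm using hg
  let f : C → RM 2 1 2 := fun c =>
    Quotient.mk (isoSetoid 2 1 2) ⟨(H c).comap e, (hm c).comap e⟩
  have hf : Function.Bijective f := by
    constructor
    · intro c c' hcc
      have hi : ((H c).comap e).Isomorphic ((H c').comap e) := Quotient.exact hcc
      have hi' := (comap_isomorphic (H c) e).symm.trans (hi.trans (comap_isomorphic (H c') e))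
      exact Subtype.ext (eq_of_isomorphic (hC c).1 (hC c').1 (hC c).2 (hC c').2 (hH c) (hH c')
        (hr c) (hr c') hi')
    · intro q
      induction q using Quotient.inductionOn with
      | h G =>
        obtain ⟨c, hc, ha, H', a', b', p', h', -, hi⟩ := exists_accepted G.2
        refine ⟨⟨c, List.mem_filter.2 ⟨hc, ha⟩⟩, Quotient.sound ?_⟩
        change ((H _).comap e).Isomorphic G.1
        rw [(hH ⟨c, List.mem_filter.2 ⟨hc, ha⟩⟩).eq h']
        exact (comap_isomorphic H' e).trans hi
  rw [← Nat.card_congr (Equiv.ofBijective f hf), ← length_filter_accepted,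
    ← List.toFinset_card_of_nodup (nodup_rootedTables.filter _), ← Fintype.card_coe,
    ← Nat.card_eq_fintype_card]
  exact Nat.card_congr (Equiv.subtypeEquivRight fun c => List.mem_toFinset.symm)

/-! ### The two graphs closest to mixed Moore graphs -/

theorem coded_G₁ : Coded 0x68767032101 0x9a98a454325 0x52413970a86 G₁
    ![1, 0, 1, 2, 3, 0, 7, 6, 7, 8, 6] ![5, 2, 3, 4, 5, 4, 10, 8, 9, 10, 9]
    ![6, 8, 10, 0, 7, 9, 3, 1, 4, 2, 5] where
  edge := by
    change ∀ v w, hexagonPentagon.Adj v w ↔ _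
    simp only [hexagonPentagon, SimpleGraph.fromRel_adj]
    decide
  ne := by decide
  arc := by
    unfold G₁
    decide
  bij := Finite.injective_iff_bijective.1 (by decide)
  tabA := by unfold Tab; decide
  tabB := by unfold Tab; decide
  tabP := by unfold Tab; decide

theorem coded_G₂ : Coded 0x68767032101 0x9a98a454325 0x2413975a86 G₂
    ![1, 0, 1, 2, 3, 0, 7, 6, 7, 8, 6] ![5, 2, 3, 4, 5, 4, 10, 8, 9, 10, 9]
    ![6, 8, 10, 5, 7, 9, 3, 1, 4, 2, 0] where
  edge := coded_G₁.edge
  ne := by decide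
  arc := by
    unfold G₂
    decide
  bij := Finite.injective_iff_bijective.1 (by decide)
  tabA := by unfold Tab; decide
  tabB := by unfold Tab; decide
  tabP := by unfold Tab; decide

/-- The labelling of the first graph with tables `code₁`. -/
def perm₁ : Equiv.Perm (Fin 11) where
  toFun := ![0, 1, 5, 6, 2, 8, 4, 9, 10, 7, 3]
  invFun := ![0, 1, 4, 10, 6, 2, 3, 9, 5, 7, 8]
  left_inv := by decide
  right_inv := by decide

/-- The labelling of the second graph with tables `code₂`. -/
def perm₂ : Equiv.Perm (Fin 11) where
  toFun := ![0, 5, 1, 6, 4, 9, 2, 8, 7, 10, 3]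
  invFun := ![0, 2, 6, 10, 4, 1, 3, 8, 7, 5, 9]
  left_inv := by decide
  right_inv := by decide

/-- Tables of a relabelled graph, verified on the tables of the original graph. -/
theorem Coded.comap {A B P A' B' P' : ℕ} {G : MixedGraph (Fin 11)}
    {a b p a' b' p' : Fin 11 → Fin 11} (h : Coded A B P G a b p) (σ : Equiv.Perm (Fin 11))
    (he : ∀ i j, (σ j = a (σ i) ∨ σ j = b (σ i)) ↔ (j = a' i ∨ j = b' i)) (hne : ∀ i, a' i ≠ b' i)
    (ha : ∀ i j, σ j = p (σ i) ↔ j = p' i) (hp : Function.Injective p') (hA : Tab A' a')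
    (hB : Tab B' b') (hP : Tab P' p') : Coded A' B' P' (G.comap σ) a' b' p' where
  edge i j := (h.edge (σ i) (σ j)).trans (he i j)
  ne := hne
  arc i j := (h.arc (σ i) (σ j)).trans (ha i j)
  bij := Finite.injective_iff_bijective.1 hp
  tabA := hA
  tabB := hB
  tabP := hP

theorem coded_comap_G₁ : Coded code₁.1 code₁.2.1 code₁.2.2 (G₁.comap perm₁)
    ![1, 0, 0, 8, 1, 7, 2, 5, 3, 3, 4] ![2, 4, 6, 9, 10, 9, 10, 8, 7, 5, 6]
    ![3, 5, 7, 10, 8, 6, 9, 4, 2, 1, 0] :=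
  coded_G₁.comap perm₁ (by decide) (by decide) (by decide) (by decide) (by unfold Tab; decide)
    (by unfold Tab; decide) (by unfold Tab; decide)

theorem coded_comap_G₂ : Coded code₂.1 code₂.2.1 code₂.2.2 (G₂.comap perm₂)
    ![1, 0, 0, 8, 1, 7, 2, 5, 3, 3, 4] ![2, 4, 6, 9, 10, 9, 10, 8, 7, 5, 6]
    ![3, 5, 7, 10, 8, 6, 9, 4, 2, 0, 1] :=
  coded_G₂.comap perm₂ (by decide) (by decide) (by decide) (by decide) (by unfold Tab; decide)
    (by unfold Tab; decide) (by unfold Tab; decide)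

/-- The arcs of the first graph form cycles of lengths 3, 4, 4, so that following twelve arcs leads
back to the start; the second graph has a cycle of length 7. -/
theorem not_isomorphic : ¬ G₁.Isomorphic G₂ := by
  rintro ⟨e, -, he⟩
  have hs : Function.Semiconj e ![6, 8, 10, 0, 7, 9, 3, 1, 4, 2, 5]
      ![6, 8, 10, 5, 7, 9, 3, 1, 4, 2, 0] := fun u =>
    (coded_G₂.arc _ _).1 ((he _ _).2 ((coded_G₁.arc _ _).2 rfl))
  have h12 := hs.iterate_right 12 (e.symm 0)
  have h1 : ∀ u : Fin 11, (![6, 8, 10, 0, 7, 9, 3, 1, 4, 2, 5] : Fin 11 → Fin 11)^[12] u = u := by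
    decide
  rw [h1, e.apply_symm_apply] at h12
  revert h12
  decide

/-- Computation of the status of every vertex, and the resulting data of the graph, from tables for
which the kernel evaluates the balls. -/
theorem Coded.summary {A B P : ℕ} {G : MixedGraph (Fin 11)} {a b p : Fin 11 → Fin 11}
    (h : Coded A B P G a b p) (d : Fin 11 → ℕ) (v₀ v₁ : Fin 11) (hv₀ : d v₀ = 0)
    (hv₁ : d v₁ ≠ 0) (hd : ∀ i : Fin 11, deficit (balls A B P) i = d i)
    (h3 : diamLe A B P (balls A B P) = true) :
    G.IsRadialMoore 2 1 2 ∧ ∀ i, G.status i = (17 + d i : ℕ) := by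
  have h3 := h.diamLe_iff.1 h3
  have hball : ∀ i, d i = 0 ↔ ∀ j, G.dist i j ≤ (2 : ℕ) := by
    intro i
    have hn := h.ncard_add_deficit i
    rw [hd] at hn
    constructor
    · intro h0
      have hu : {j | G.dist i j ≤ (2 : ℕ)} = Set.univ := by
        rw [Set.eq_univ_iff_ncard, Nat.card_eq_fintype_card, Fintype.card_fin]
        omega
      exact fun j => hu.ge (Set.mem_univ j)
    · intro hj
      have hu : {j | G.dist i j ≤ (2 : ℕ)} = Set.univ := Set.eq_univ_of_forall hj
      rw [hu, Set.ncard_univ, Nat.card_eq_fintype_card, Fintype.card_fin] at hn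
      omega
  refine ⟨(h.toNbrs.isRadialMoore_iff (by simp)).2 ⟨⟨v₀, (hball v₀).1 hv₀⟩, h3, v₁, ?_⟩, ?_⟩
  · by_contra! hc
    exact hv₁ ((hball v₁).2 hc)
  · intro i
    rw [h.status_eq h3, hd]

/-- The difference of the status of a vertex and the status in a mixed Moore graph; it is the same
in both graphs. -/
def excess (i : ℕ) : ℕ := [0, 0, 1, 2, 1, 0, 0, 1, 1, 1, 1].getD i 0

theorem summary_G₁ : G₁.IsRadialMoore 2 1 2 ∧ ∀ i : Fin 11, G₁.status i = (17 + excess i : ℕ) :=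
  coded_G₁.summary (fun i => excess i) 0 2 rfl (by decide) (by decide +kernel) (by decide +kernel)

theorem summary_G₂ : G₂.IsRadialMoore 2 1 2 ∧ ∀ i : Fin 11, G₂.status i = (17 + excess i : ℕ) :=
  coded_G₂.summary (fun i => excess i) 0 2 rfl (by decide) (by decide +kernel) (by decide +kernel)

theorem statusVector_of_status_eq_excess {G : MixedGraph (Fin 11)}
    (hG : ∀ i : Fin 11, G.status i = (17 + excess i : ℕ)) : G.statusVector =
    Multiset.replicate 4 17 + Multiset.replicate 6 18 + Multiset.replicate 1 19 := by
  have hn : ((Finset.univ : Finset (Fin 11)).val.map fun i : Fin 11 => 17 + excess i) =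
      Multiset.replicate 4 17 + Multiset.replicate 6 18 + Multiset.replicate 1 19 := by
    decide
  rw [statusVector, Multiset.map_congr rfl fun i _ => hG i]
  simpa only [Multiset.map_map, Multiset.map_add, Multiset.map_replicate, Function.comp_def,
    Nat.cast_ofNat]
    using congrArg (Multiset.map (Nat.cast : ℕ → ℕ∞)) hn

theorem statusNorm_one_of_status_eq_excess {G : MixedGraph (Fin 11)}
    (hG : ∀ i : Fin 11, G.status i = (17 + excess i : ℕ)) : G.statusNorm 2 1 2 1 = 8 := by
  have hs : (verts.map fun i => excess i ^ 1).sum = 8 := by decide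
  rw [statusNorm_of_status_eq hG, hs]
  norm_num

/-- At most the norms for `p = 1` and `p = 2` have to be compared. -/
theorem closer_of_sum_le {G : MixedGraph (Fin 11)}
    (hG : ∀ i : Fin 11, G.status i = (17 + excess i : ℕ)) {V : Type*} [Fintype V]
    {H : MixedGraph V} {d : ℕ → ℕ}
    (hH : ∀ q, H.statusNorm 2 1 2 q = (((verts.map fun i => d i ^ q).sum : ℕ) : ℝ) ^ (1 / (q : ℝ)))
    (h1 : 8 ≤ (verts.map d).sum)
    (h2 : 9 ≤ (verts.map d).sum ∨ 11 ≤ (verts.map fun i => d i ^ 2).sum) :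
    Closer 2 1 2 G H := by
  have hG1 : G.statusNorm 2 1 2 1 = 8 := statusNorm_one_of_status_eq_excess hG
  have hH1 : H.statusNorm 2 1 2 1 = ((verts.map d).sum : ℕ) := by
    rw [hH]
    simp only [pow_one, Nat.cast_one, div_one, Real.rpow_one]
  have hs : (verts.map fun i => excess i ^ 2).sum = 10 := by decide
  rcases h1.lt_or_eq with h1 | h1
  · refine ⟨1, one_pos, fun p hp hp' => absurd hp' (Nat.not_lt.2 hp), ?_⟩
    rw [hG1, hH1]
    exact_mod_cast h1
  · refine ⟨2, two_pos, fun p hp hp' => ?_, ?_⟩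
    · obtain rfl : p = 1 := by omega
      rw [hG1, hH1, ← h1]
      norm_num
    · rw [statusNorm_of_status_eq hG, hH, hs]
      refine Real.rpow_lt_rpow (Nat.cast_nonneg _) (Nat.cast_lt.2 ?_) (by norm_num)
      omega

/-- A radial Moore graph other than the two exceptional ones is isomorphic to the graph of an
accepted triple, and as this triple is far, it has larger deficits. -/
theorem exists_deficit {V : Type*} [Fintype V] {G : MixedGraph V} (hG : G.IsRadialMoore 2 1 2)
    (h₁ : ¬ G.Isomorphic G₁) (h₂ : ¬ G.Isomorphic G₂) : ∃ d : ℕ → ℕ,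
      (∀ q, G.statusNorm 2 1 2 q = (((verts.map fun i => d i ^ q).sum : ℕ) : ℝ) ^ (1 / (q : ℝ))) ∧
      8 ≤ (verts.map d).sum ∧
      (9 ≤ (verts.map d).sum ∨ 11 ≤ (verts.map fun i => d i ^ 2).sum) := by
  obtain ⟨c, hc, ha, H, a, b, p, h, -, hi⟩ := exists_accepted hG
  have hf : far c.1 c.2.1 c.2.2 (ownBalls c) = true := isFar_of_accepted hc ha
  have hst : ∀ i : Fin 11, H.status i = (17 + deficit (ownBalls c) i : ℕ) :=
    h.status_eq (h.diamLe_iff.1 (accepted_iff.1 ha).2.2.1)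
  have hc₁ : c ≠ code₁ := by
    rintro rfl
    rw [h.eq coded_comap_G₁] at hi
    exact h₁ (hi.symm.trans (comap_isomorphic G₁ perm₁))
  have hc₂ : c ≠ code₂ := by
    rintro rfl
    rw [h.eq coded_comap_G₂] at hi
    exact h₂ (hi.symm.trans (comap_isomorphic G₂ perm₂))
  obtain ⟨hf1, hf2⟩ := far_iff.1 hf
  generalize deficit (ownBalls c) = d at hst hf1 hf2
  refine ⟨d, fun q => ?_, hf1, ?_⟩
  · rw [← statusNorm_of_status_eq hst, statusNorm_of_isomorphic hi]
  · rcases hf2 with hf | hf | hf | hf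
    · exact .inl hf
    · exact .inr hf
    · exact absurd hf hc₁
    · exact absurd hf hc₂

end

end MixedGraph

theorem mainTheorem7 :
    -- there are exactly 9486 mixed radial Moore graphs with these parameters
    Nat.card (MixedGraph.RM 2 1 2) = 9486 ∧
    -- the two graphs are among them, and they are different
    MixedGraph.G₁.IsRadialMoore 2 1 2 ∧ MixedGraph.G₂.IsRadialMoore 2 1 2 ∧
    ¬ MixedGraph.G₁.Isomorphic MixedGraph.G₂ ∧
    -- their status vectors and status norms
    MixedGraph.G₁.statusVector =
      Multiset.replicate 4 17 + Multiset.replicate 6 18 + Multiset.replicate 1 19 ∧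
    MixedGraph.G₂.statusVector =
      Multiset.replicate 4 17 + Multiset.replicate 6 18 + Multiset.replicate 1 19 ∧
    MixedGraph.G₁.statusNorm 2 1 2 1 = 8 ∧ MixedGraph.G₂.statusNorm 2 1 2 1 = 8 ∧
    -- they are the first two: both precede every other graph
    (∀ (V : Type*) [Fintype V] (G : MixedGraph V), G.IsRadialMoore 2 1 2 →
      ¬ G.Isomorphic MixedGraph.G₁ → ¬ G.Isomorphic MixedGraph.G₂ →
        MixedGraph.Closer 2 1 2 MixedGraph.G₁ G ∧
        MixedGraph.Closer 2 1 2 MixedGraph.G₂ G) := by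
  obtain ⟨hm₁, hs₁⟩ := MixedGraph.summary_G₁
  obtain ⟨hm₂, hs₂⟩ := MixedGraph.summary_G₂
  refine ⟨MixedGraph.card_RM, hm₁, hm₂, MixedGraph.not_isomorphic,
    MixedGraph.statusVector_of_status_eq_excess hs₁,
    MixedGraph.statusVector_of_status_eq_excess hs₂,
    MixedGraph.statusNorm_one_of_status_eq_excess hs₁,
    MixedGraph.statusNorm_one_of_status_eq_excess hs₂, fun V _ G hG h₁ h₂ => ?_⟩
  obtain ⟨d, hn, hd, hd'⟩ := MixedGraph.exists_deficit hG h₁ h₂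
  exact ⟨MixedGraph.closer_of_sum_le hs₁ hn hd hd', MixedGraph.closer_of_sum_le hs₂ hn hd hd'⟩
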